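/- Let $\mathcal{L}$ be a fixed homogeneous linear equation $a_1x_1+\dots+a_\ell x_\ell=0$ with integer coefficients that is not translation-invariant, i.e. $\sum_{i=1}^{\ell} a_i\neq 0$. A solution $(x_1,\dots,x_\ell)$ of $\mathcal{L}$ is trivial if $\{1,\dots,\ell\}$ can be partitioned into classes on each of which $x_i$ is constant and $\sum a_i=0$; a set of integers is $\mathcal{L}$-free if it contains no non-trivial solution of $\mathcal{L}$. For a finite set $A\subseteq\mathbb{Z}$ and $k\in\mathbb{N}$, let $N_{\mathcal{L}}(A,k)$ be the number of $\mathcal{L}$-free subsets of $A$ of cardinality exactly $k$. Then the problem of computing $N_{\mathcal{L}}(A,k)$, parameterised by $k$, admits a fixed parameter tractable randomised approximation scheme (FPTRAS). That is, there are a randomised algorithm, a computable function $f:\mathbb{N}\to\mathbb{N}$ and a polynomial $g$ in three variables, all depending only on $\mathcal{L}$, such that for every instance $(A,k)$ and all rational numbers $\varepsilon>0$ and $0<\delta<1$, the algorithm on input $(A,k)$, $\varepsilon$, $\delta$ halts, for every outcome of its coin tosses, within time $$f(k)\cdot g\bigl(n,\,1/\varepsilon,\,\log(1/\delta)\bigr),$$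 where $n$ is the number of bits of the instance $(A,k)$, and outputs a rational number $z$ with $$\mathbb{P}\bigl[(1-\varepsilon)\,N_{\mathcal{L}}(A,k)\le z\le(1+\varepsilon)\,N_{\mathcal{L}}(A,k)\bigr]\ge 1-\delta .$$ Here an algorithm is a program for a random access machine that can add, subtract, multiply and compare integers with $0$, address memory indirectly and toss fair coins, and whose time is measured by the logarithmic (bit) cost. The integer $k$ and the elements of $A$ (each once, in any order) are stored in an array. Each of $\varepsilon$ and $\delta$ is given by the binary digits of its numerator and denominator in lowest terms, most significant digit first and padded with leading zeros to equal length. -/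

import Mathlib

noncomputable section

namespace SolutionFree

/-! ### Linear equations and solution-free sets -/

/-- A linear equation `a₁ x₁ + ⋯ + a_ℓ x_ℓ = b` with integer coefficients. -/
structure LinearEq where
  numVars : ℕ
  coeff : Fin numVars → ℤ
  rhs : ℤ

namespace LinearEq

variable (L : LinearEq)

def Homogeneous : Prop := L.rhs = 0

def TranslationInvariant : Prop := ∑ i, L.coeff i = 0 ∧ L.rhs = 0

def IsSolution (x : Fin L.numVars → ℤ) : Prop := ∑ i, L.coeff i * x i = L.rhs

/-- `x` is trivial if the index set can be partitioned into classes on each of which `x` is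
constant and the coefficients sum to zero. -/
def IsTrivial (x : Fin L.numVars → ℤ) : Prop :=
  ∃ P : Finpartition (Finset.univ : Finset (Fin L.numVars)),
    (∀ p ∈ P.parts, ∀ i ∈ p, ∀ j ∈ p, x i = x j) ∧ ∀ p ∈ P.parts, ∑ i ∈ p, L.coeff i = 0

/-- `S` contains no non-trivial solution of the equation. -/
def IsFree (S : Set ℤ) : Prop :=
  ∀ x : Fin L.numVars → ℤ, (∀ i, x i ∈ S) → L.IsSolution x → L.IsTrivial x

end LinearEq

/-! ### A randomised random access machine with logarithmic cost

Programs act on finitely many integer variables and finitely many integer arrays (those named in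
the program text).  Every elementary operation is charged the number of bits of its operands. -/

/-- Number of bits of an integer (one bit for the sign). -/
def bitLen (z : ℤ) : ℕ := Nat.size z.natAbs + 1

/-- Arithmetic operations of the machine. -/
inductive Op
  | add
  | sub
  | mul

def Op.eval : Op → ℤ → ℤ → ℤ
  | .add, x, y => x + y
  | .sub, x, y => x - y
  | .mul, x, y => x * y

/-- Programs.  The natural numbers `x y z` name variables, `a` names an array. -/
inductive Cmd
  /-- do nothing -/
  | skip
  /-- `x := c` for a constant `c` -/
  | const (x : ℕ) (c : ℤ)
  /-- `x := y ∘ z` for an arithmetic operation `∘` -/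
  | arith (x : ℕ) (o : Op) (y z : ℕ)
  /-- `x := a[y]` -/
  | load (x a y : ℕ)
  /-- `a[y] := z` -/
  | store (a y z : ℕ)
  /-- `x :=` the result (`0` or `1`) of a fresh fair coin toss -/
  | flip (x : ℕ)
  /-- first `p`, then `q` -/
  | seq (p q : Cmd)
  /-- if `x > 0` then `p` else `q` -/
  | cond (x : ℕ) (p q : Cmd)
  /-- while `x > 0` do `p` -/
  | loop (x : ℕ) (p : Cmd)

/-- A memory state: the values of the variables, the contents of the arrays, and the number of
coins tossed so far. -/
@[ext]
structure State where
  var : ℕ → ℤ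
  arr : ℕ → ℕ → ℤ
  used : ℕ

namespace State

def setVar (s : State) (x : ℕ) (v : ℤ) : State :=
  { s with var := Function.update s.var x v }

def setArr (s : State) (a i : ℕ) (v : ℤ) : State :=
  { s with arr := Function.update s.arr a (Function.update (s.arr a) i v) }

/-- The array index held by variable `y` (a negative value is read as index `0`). -/
def index (s : State) (y : ℕ) : ℕ := (s.var y).toNat

end State

/-- `Exec ω p s s' t`: with coin tosses `ω 0, ω 1, …`, program `p` started in state `s` halts in
state `s'` after exactly `t` bit-steps. -/
inductive Exec (ω : ℕ → Bool) : Cmd → State → State → ℕ → Prop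
  | skip (s : State) : Exec ω .skip s s 1
  | const (s : State) (x : ℕ) (c : ℤ) :
      Exec ω (.const x c) s (s.setVar x c) (1 + bitLen c)
  | arith (s : State) (x : ℕ) (o : Op) (y z : ℕ) :
      Exec ω (.arith x o y z) s (s.setVar x (o.eval (s.var y) (s.var z)))
        (1 + bitLen (s.var y) + bitLen (s.var z))
  | load (s : State) (x a y : ℕ) :
      Exec ω (.load x a y) s (s.setVar x (s.arr a (s.index y)))
        (1 + bitLen (s.var y) + bitLen (s.arr a (s.index y)))
  | store (s : State) (a y z : ℕ) :
      Exec ω (.store a y z) s (s.setArr a (s.index y) (s.var z))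
        (1 + bitLen (s.var y) + bitLen (s.var z))
  | flip (s : State) (x : ℕ) :
      Exec ω (.flip x) s
        { s.setVar x (if ω s.used then 1 else 0) with used := s.used + 1 } 1
  | seq {p q : Cmd} {s s₁ s₂ : State} {t₁ t₂ : ℕ} (hp : Exec ω p s s₁ t₁)
      (hq : Exec ω q s₁ s₂ t₂) : Exec ω (.seq p q) s s₂ (t₁ + t₂)
  | condTrue {x : ℕ} {p q : Cmd} {s s' : State} {t : ℕ} (hx : 0 < s.var x)
      (hp : Exec ω p s s' t) : Exec ω (.cond x p q) s s' (1 + bitLen (s.var x) + t)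
  | condFalse {x : ℕ} {p q : Cmd} {s s' : State} {t : ℕ} (hx : ¬ 0 < s.var x)
      (hq : Exec ω q s s' t) : Exec ω (.cond x p q) s s' (1 + bitLen (s.var x) + t)
  | loopDone {x : ℕ} {p : Cmd} {s : State} (hx : ¬ 0 < s.var x) :
      Exec ω (.loop x p) s s (1 + bitLen (s.var x))
  | loopStep {x : ℕ} {p : Cmd} {s s₁ s₂ : State} {t₁ t₂ : ℕ} (hx : 0 < s.var x)
      (hp : Exec ω p s s₁ t₁) (hl : Exec ω (.loop x p) s₁ s₂ t₂) :
      Exec ω (.loop x p) s s₂ (1 + bitLen (s.var x) + t₁ + t₂)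

/-- For fixed coin tosses the machine is deterministic: final state and running time are unique. -/
theorem Exec.deterministic {ω : ℕ → Bool} {p : Cmd} {s s₁ : State} {t₁ : ℕ}
    (h₁ : Exec ω p s s₁ t₁) : ∀ {s₂ : State} {t₂ : ℕ}, Exec ω p s s₂ t₂ → s₁ = s₂ ∧ t₁ = t₂ := by
  induction h₁ with
  | skip | const | arith | load | store | flip => intro s₂ t₂ h₂; cases h₂; exact ⟨rfl, rfl⟩
  | seq _ _ ihp ihq =>
    intro s₂ t₂ h₂
    cases h₂ with
    | seq hp hq =>
      obtain ⟨rfl, rfl⟩ := ihp hp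
      obtain ⟨rfl, rfl⟩ := ihq hq
      exact ⟨rfl, rfl⟩
  | condTrue hx _ ih =>
    intro s₂ t₂ h₂
    cases h₂ with
    | condTrue _ hp => obtain ⟨rfl, rfl⟩ := ih hp; exact ⟨rfl, rfl⟩
    | condFalse hx' _ => exact absurd hx hx'
  | condFalse hx _ ih =>
    intro s₂ t₂ h₂
    cases h₂ with
    | condTrue hx' _ => exact absurd hx' hx
    | condFalse _ hp => obtain ⟨rfl, rfl⟩ := ih hp; exact ⟨rfl, rfl⟩
  | loopDone hx =>
    intro s₂ t₂ h₂
    cases h₂ with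
    | loopDone _ => exact ⟨rfl, rfl⟩
    | loopStep hx' _ _ => exact absurd hx' hx
  | loopStep hx _ _ ihp ihl =>
    intro s₂ t₂ h₂
    cases h₂ with
    | loopDone hx' => exact absurd hx hx'
    | loopStep _ hp hl =>
      obtain ⟨rfl, rfl⟩ := ihp hp
      obtain ⟨rfl, rfl⟩ := ihl hl
      exact ⟨rfl, rfl⟩

/-! ### Input and output conventions -/

/-- Number of digit pairs in the binary notation of a rational `p / q` in lowest terms. -/
def digitLen (r : ℚ) : ℕ := max (Nat.size r.num.natAbs) (Nat.size r.den)

/-- The `i`-th binary digit of `n`, most significant first, when `n` is written with `m` digits;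
`0` after the last digit. -/
def digit (m n i : ℕ) : ℤ :=
  if i < m ∧ n.testBit (m - 1 - i) then 1 else 0

/-- The initial state on input `w` (a list of integers) and rationals `ε`, `δ`.
* Array `0` holds `w`, variable `0` its length.
* Arrays `1`, `2` hold the binary digits of the numerator and of the denominator of `ε`, most
  significant first, the shorter of the two padded with leading zeros; variable `1` holds their
  common length.  So the magnitude of `ε` can be read off without reading `ε` to the last digit,
  as it must be if the running time is to depend on `ε` through `1 / ε` only.
* Arrays `3`, `4` and variable `2` hold `δ` in the same way.
* Everything else is `0`. -/
def initState (w : List ℤ) (ε δ : ℚ) : State where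
  var
    | 0 => w.length
    | 1 => digitLen ε
    | 2 => digitLen δ
    | _ => 0
  arr
    | 0 => fun i => w.getD i 0
    | 1 => digit (digitLen ε) ε.num.natAbs
    | 2 => digit (digitLen ε) ε.den
    | 3 => digit (digitLen δ) δ.num.natAbs
    | 4 => digit (digitLen δ) δ.den
    | _ => fun _ => 0
  used := 0

/-- With coin tosses `ω`, program `p` on input `w, ε, δ` halts after `t` bit-steps and outputs the
rational number `z`, given by a numerator in variable `0` and a non-zero denominator in
variable `1`. -/
def Outputs (p : Cmd) (w : List ℤ) (ε δ : ℚ) (ω : ℕ → Bool) (z : ℚ) (t : ℕ) : Prop :=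
  ∃ s, Exec ω p (initState w ε δ) s t ∧ s.var 1 ≠ 0 ∧ z = (s.var 0 : ℚ) / (s.var 1 : ℚ)

/-- The law of an infinite sequence of independent fair coin tosses. -/
def coinMeasure : MeasureTheory.Measure (ℕ → Bool) :=
  MeasureTheory.Measure.infinitePi fun _ => (PMF.uniformOfFintype Bool).toMeasure

/-- Total number of bits of a list of integers. -/
def inputSize (w : List ℤ) : ℕ := (w.map bitLen).sum

/-! ### Fixed parameter tractable randomised approximation schemes -/

/-- The counting problem `count`, with parameter `param`, admits an FPTRAS.  `Represents I w` says
that the list of integers `w` is a representation of the instance `I`.  The running time is bounded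
for every outcome of the coin tosses. -/
def AdmitsFPTRAS {Inst : Type*} (Represents : Inst → List ℤ → Prop) (count param : Inst → ℕ) :
    Prop :=
  ∃ (p : Cmd) (f : ℕ → ℕ) (g : MvPolynomial (Fin 3) ℝ), Computable f ∧
    ∀ (I : Inst) (w : List ℤ), Represents I w →
      ∀ ε δ : ℚ, 0 < ε → 0 < δ → δ < 1 →
        (∀ ω : ℕ → Bool, ∃ (z : ℚ) (t : ℕ), Outputs p w ε δ ω z t ∧
          (t : ℝ) ≤ (f (param I) : ℝ) *
            MvPolynomial.eval ![(inputSize w : ℝ), 1 / (ε : ℝ), Real.log (1 / (δ : ℝ))] g) ∧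
        1 - (δ : ℝ) ≤ coinMeasure.real {ω | ∃ (z : ℚ) (t : ℕ), Outputs p w ε δ ω z t ∧
          (1 - ε) * (count I : ℚ) ≤ z ∧ z ≤ (1 + ε) * (count I : ℚ)}

/-! ### The counting problem -/

/-- An instance: a finite set `A` of integers and a natural number `k`. -/
structure Instance where
  A : Finset ℤ
  k : ℕ

/-- An instance `(A, k)` is written as `k` followed by the elements of `A`, each once, in any
order. -/
def Instance.Represents (I : Instance) (w : List ℤ) : Prop :=
  ∃ l : List ℤ, l.Nodup ∧ l.toFinset = I.A ∧ w = (I.k : ℤ) :: l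

/-- The number of solution-free subsets of `A` with exactly `k` elements. -/
def LinearEq.countFree (L : LinearEq) (I : Instance) : ℕ :=
  {B : Finset ℤ | B ⊆ I.A ∧ B.card = I.k ∧ L.IsFree (B : Set ℤ)}.ncard

end SolutionFree

end

/-!
The algorithm is plain Monte Carlo sampling. Since the coefficients do not sum to zero, no solution
is trivial, so a set is solution-free if and only if it contains no solution whatever. By an
argument of Erdős, every finite set of nonzero integers has a solution-free subset of positive
density (`LinearEq.exists_isFree_subset`): dilate the set at random modulo a large prime and keep
what falls into a short interval on which the left-hand side of the equation cannot vanish. All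
`k`-subsets of that subset are solution-free. Hence, as soon as there is one solution-free
`k`-subset, they make up a proportion of all `k`-tuples of positions that is bounded below in terms
of `k` alone (`LinearEq.pow_le_mul_countFree`); small sets are covered by the same bound.

A sample consists of `k` positions, each made of `m` coins, where `2 ^ m` is the least power of two
not below the size of the set. It is a success if the positions are in range, strictly increasing,
and carry a solution-free set. Rejecting everything else keeps the number of coins per sample constant, so that samples are
independent, and each solution-free `k`-subset corresponds to exactly one successful outcome
(`card_success`). Hoeffding's inequality (`measureReal_success_deviation`) shows that
`(E * D) ^ 2 * G` samples suffice, where `1 / D` is the lower bound for the proportion, `1 / E ≤ ε`,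
and `G` is of the order of `log (1 / δ)`. The numbers `E` and `G` are found by scanning the
numerators of `ε` and `δ` for the first digit `1`, which takes time bounded in terms of `1 / ε` and
`log (1 / δ)` however many digits there are. The subset found by Erdős's argument is never computed.

For the running time it is enough to know one number `Z` that bounds the length of all operands and
the number of rounds of all loops: the running time is then at most `Cmd.cost Z`, a polynomial in
`Z` that depends on the program only (`Cmd.exists_cost_le`). The weakest-precondition predicate `WP`
has this bound built in, so the correctness proof of each part of the program (culminating in
`approxProg_wp`) needs, in place of a running-time analysis, only estimates for the values that
occur. A suitable `Z` is a function of `k` times a polynomial in the other quantities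
(`exists_run`).
-/

namespace SolutionFree

/-! ### Reasoning about programs -/

/-- A bound for the running time of a program all of whose operands have at most `Z` bits and all
of whose loops run at most `Z` times. -/
def Cmd.cost (Z : ℕ) : Cmd → ℕ
  | .skip => 1
  | .const _ _ => 1 + Z
  | .arith _ _ _ _ => 1 + Z + Z
  | .load _ _ _ => 1 + Z + Z
  | .store _ _ _ => 1 + Z + Z
  | .flip _ => 1
  | .seq p q => p.cost Z + q.cost Z
  | .cond _ p q => 1 + Z + (p.cost Z + q.cost Z)
  | .loop _ p => (Z + 1) * (1 + Z + p.cost Z)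

/-- For a fixed program the time bound is polynomial in `Z`. -/
theorem Cmd.exists_cost_le (p : Cmd) : ∃ c r : ℕ, ∀ Z, p.cost Z ≤ c * (Z + 1) ^ r := by
  have add_le : ∀ {c₁ r₁ c₂ r₂ a b Z : ℕ}, a ≤ c₁ * (Z + 1) ^ r₁ → b ≤ c₂ * (Z + 1) ^ r₂ →
      a + b ≤ (c₁ + c₂) * (Z + 1) ^ (r₁ + r₂) := by
    intro c₁ r₁ c₂ r₂ a b Z h₁ h₂
    have e₁ : (Z + 1) ^ r₁ ≤ (Z + 1) ^ (r₁ + r₂) := Nat.pow_le_pow_right (by omega) (by omega)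
    have e₂ : (Z + 1) ^ r₂ ≤ (Z + 1) ^ (r₁ + r₂) := Nat.pow_le_pow_right (by omega) (by omega)
    have := Nat.mul_le_mul_left c₁ e₁
    have := Nat.mul_le_mul_left c₂ e₂
    rw [add_mul]
    omega
  induction p with
  | skip => exact ⟨1, 0, fun Z => by simp [Cmd.cost]⟩
  | flip => exact ⟨1, 0, fun Z => by simp [Cmd.cost]⟩
  | const | arith | load | store =>
    exact ⟨2, 1, fun Z => by simp only [Cmd.cost, pow_one]; omega⟩
  | seq p q ihp ihq =>
    obtain ⟨c₁, r₁, h₁⟩ := ihp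
    obtain ⟨c₂, r₂, h₂⟩ := ihq
    exact ⟨_, _, fun Z => add_le (h₁ Z) (h₂ Z)⟩
  | cond x p q ihp ihq =>
    obtain ⟨c₁, r₁, h₁⟩ := ihp
    obtain ⟨c₂, r₂, h₂⟩ := ihq
    exact ⟨_, _, fun Z => add_le (c₁ := 1) (r₁ := 1) (by rw [pow_one]; omega)
      (add_le (h₁ Z) (h₂ Z))⟩
  | loop x p ih =>
    obtain ⟨c, r, h⟩ := ih
    refine ⟨1 + c, 1 + r + 1, fun Z => ?_⟩
    have := add_le (c₁ := 1) (r₁ := 1) (a := 1 + Z) (Z := Z) (by rw [pow_one]; omega) (h Z)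
    calc (Z + 1) * (1 + Z + p.cost Z) ≤ (Z + 1) * ((1 + c) * (Z + 1) ^ (1 + r)) :=
          Nat.mul_le_mul_left _ this
      _ = _ := by ring

/-- Weakest precondition with a resource bound: started in `s`, the program `p` halts within time
`p.cost Z` in a state satisfying `Q`. -/
def WP (ω : ℕ → Bool) (Z : ℕ) (p : Cmd) (Q : State → Prop) (s : State) : Prop :=
  ∃ s' t, Exec ω p s s' t ∧ t ≤ p.cost Z ∧ Q s'

namespace WP

variable {ω : ℕ → Bool} {Z : ℕ} {p q : Cmd} {Q R : State → Prop} {s : State}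

theorem mono (h : WP ω Z p Q s) (hQR : ∀ s', Q s' → R s') : WP ω Z p R s := by
  obtain ⟨s', t, he, ht, hq⟩ := h
  exact ⟨s', t, he, ht, hQR _ hq⟩

theorem skip (h : Q s) : WP ω Z .skip Q s := ⟨s, 1, .skip s, le_rfl, h⟩

theorem const {x : ℕ} {c : ℤ} (hc : bitLen c ≤ Z) (h : Q (s.setVar x c)) :
    WP ω Z (.const x c) Q s :=
  ⟨_, _, .const s x c, by simp only [Cmd.cost]; omega, h⟩

theorem arith {x y z : ℕ} {o : Op} (hy : bitLen (s.var y) ≤ Z) (hz : bitLen (s.var z) ≤ Z)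
    (h : Q (s.setVar x (o.eval (s.var y) (s.var z)))) : WP ω Z (.arith x o y z) Q s :=
  ⟨_, _, .arith s x o y z, by simp only [Cmd.cost]; omega, h⟩

theorem load {x a y : ℕ} (hy : bitLen (s.var y) ≤ Z) (hv : bitLen (s.arr a (s.index y)) ≤ Z)
    (h : Q (s.setVar x (s.arr a (s.index y)))) : WP ω Z (.load x a y) Q s :=
  ⟨_, _, .load s x a y, by simp only [Cmd.cost]; omega, h⟩

theorem store {a y z : ℕ} (hy : bitLen (s.var y) ≤ Z) (hz : bitLen (s.var z) ≤ Z)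
    (h : Q (s.setArr a (s.index y) (s.var z))) : WP ω Z (.store a y z) Q s :=
  ⟨_, _, .store s a y z, by simp only [Cmd.cost]; omega, h⟩

theorem flip {x : ℕ}
    (h : Q { s.setVar x (if ω s.used then 1 else 0) with used := s.used + 1 }) :
    WP ω Z (.flip x) Q s :=
  ⟨_, _, .flip s x, le_rfl, h⟩

theorem seq (h : WP ω Z p (WP ω Z q Q) s) : WP ω Z (.seq p q) Q s := by
  obtain ⟨s₁, t₁, he₁, ht₁, s₂, t₂, he₂, ht₂, h⟩ := h
  exact ⟨s₂, _, .seq he₁ he₂, by simp only [Cmd.cost]; omega, h⟩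

theorem cond {x : ℕ} (hx : bitLen (s.var x) ≤ Z) (hp : 0 < s.var x → WP ω Z p Q s)
    (hq : ¬ 0 < s.var x → WP ω Z q Q s) : WP ω Z (.cond x p q) Q s := by
  by_cases h : 0 < s.var x
  · obtain ⟨s', t, he, ht, hQ⟩ := hp h
    exact ⟨s', _, .condTrue h he, by simp only [Cmd.cost]; omega, hQ⟩
  · obtain ⟨s', t, he, ht, hQ⟩ := hq h
    exact ⟨s', _, .condFalse h he, by simp only [Cmd.cost]; omega, hQ⟩

/-- The rule for a loop that runs exactly `N` times, with an invariant that may refer to the number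
of completed rounds. -/
theorem loop {x N : ℕ} (I : ℕ → State → Prop) (hN : N ≤ Z) (h0 : I 0 s)
    (hbit : ∀ i s, i ≤ N → I i s → bitLen (s.var x) ≤ Z)
    (hstep : ∀ i s, i < N → I i s → 0 < s.var x ∧ WP ω Z p (I (i + 1)) s)
    (hend : ∀ s, I N s → ¬ 0 < s.var x) : WP ω Z (.loop x p) (I N) s := by
  suffices H : ∀ d i s, i + d = N → I i s →
      ∃ s' t, Exec ω (.loop x p) s s' t ∧ t ≤ (d + 1) * (1 + Z + p.cost Z) ∧ I N s' by
    obtain ⟨s', t, he, ht, h⟩ := H N 0 s (by omega) h0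
    exact ⟨s', t, he, ht.trans (Nat.mul_le_mul_right _ (by omega)), h⟩
  intro d
  induction d with
  | zero =>
    intro i s hi hs
    obtain rfl : i = N := by omega
    have := hbit i s le_rfl hs
    exact ⟨s, _, .loopDone (hend s hs), by omega, hs⟩
  | succ d ih =>
    intro i s hi hs
    obtain ⟨hx, s₁, t₁, he₁, ht₁, h₁⟩ := hstep i s (by omega) hs
    obtain ⟨s₂, t₂, he₂, ht₂, h₂⟩ := ih (i + 1) s₁ (by omega) h₁
    have := hbit i s (by omega) hs
    refine ⟨s₂, _, .loopStep hx he₁ he₂, ?_, h₂⟩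
    rw [add_mul]
    omega

end WP

/-- The variables written by a program. -/
def Cmd.vars : Cmd → Set ℕ
  | .skip => ∅
  | .const x _ => {x}
  | .arith x _ _ _ => {x}
  | .load x _ _ => {x}
  | .store _ _ _ => ∅
  | .flip x => {x}
  | .seq p q => p.vars ∪ q.vars
  | .cond _ p q => p.vars ∪ q.vars
  | .loop _ p => p.vars

/-- The arrays written by a program. -/
def Cmd.arrs : Cmd → Set ℕ
  | .skip => ∅
  | .const _ _ => ∅
  | .arith _ _ _ _ => ∅
  | .load _ _ _ => ∅
  | .store a _ _ => {a}
  | .flip _ => ∅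
  | .seq p q => p.arrs ∪ q.arrs
  | .cond _ p q => p.arrs ∪ q.arrs
  | .loop _ p => p.arrs

/-- The program tosses a coin. -/
def Cmd.Flips : Cmd → Prop
  | .flip _ => True
  | .seq p q => p.Flips ∨ q.Flips
  | .cond _ p q => p.Flips ∨ q.Flips
  | .loop _ p => p.Flips
  | _ => False

theorem Exec.frame {ω : ℕ → Bool} {p : Cmd} {s s' : State} {t : ℕ} (h : Exec ω p s s' t) :
    (∀ x ∉ p.vars, s'.var x = s.var x) ∧ (∀ a ∉ p.arrs, s'.arr a = s.arr a) ∧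
      (¬ p.Flips → s'.used = s.used) := by
  induction h with
  | seq _ _ ihp ihq =>
    simp only [Cmd.vars, Cmd.arrs, Cmd.Flips, Set.mem_union, not_or]
    exact ⟨fun x hx => (ihq.1 x hx.2).trans (ihp.1 x hx.1),
      fun x hx => (ihq.2.1 x hx.2).trans (ihp.2.1 x hx.1),
      fun h => (ihq.2.2 h.2).trans (ihp.2.2 h.1)⟩
  | condTrue _ _ ih | condFalse _ _ ih =>
    simp only [Cmd.vars, Cmd.arrs, Cmd.Flips, Set.mem_union, not_or]
    grind
  | loopDone => simp
  | loopStep _ _ _ ih ihl =>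
    simp only [Cmd.vars, Cmd.arrs, Cmd.Flips] at *
    exact ⟨fun x hx => (ihl.1 x hx).trans (ih.1 x hx),
      fun x hx => (ihl.2.1 x hx).trans (ih.2.1 x hx), fun h => (ihl.2.2 h).trans (ih.2.2 h)⟩
  | _ =>
    simp +contextual [Cmd.vars, Cmd.arrs, Cmd.Flips, State.setVar, State.setArr]

/-- The frame rule: a program leaves alone whatever it does not mention as a target. -/
theorem WP.frame {ω : ℕ → Bool} {Z : ℕ} {p : Cmd} {Q : State → Prop} {s : State}
    (h : WP ω Z p Q s) :
    WP ω Z p (fun s' => Q s' ∧ (∀ x ∉ p.vars, s'.var x = s.var x) ∧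
      (∀ a ∉ p.arrs, s'.arr a = s.arr a) ∧ (¬ p.Flips → s'.used = s.used)) s := by
  obtain ⟨s', t, he, ht, hq⟩ := h
  exact ⟨s', t, he, ht, hq, he.frame⟩

namespace State

@[simp] theorem setVar_var (s : State) (x y : ℕ) (v : ℤ) :
    (s.setVar x v).var y = if y = x then v else s.var y := by
  simp [setVar, Function.update_apply]

@[simp] theorem setVar_arr (s : State) (x : ℕ) (v : ℤ) : (s.setVar x v).arr = s.arr := rfl

@[simp] theorem setVar_used (s : State) (x : ℕ) (v : ℤ) : (s.setVar x v).used = s.used := rfl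

@[simp] theorem setArr_var (s : State) (a i : ℕ) (v : ℤ) : (s.setArr a i v).var = s.var := rfl

@[simp] theorem setArr_arr (s : State) (a i b j : ℕ) (v : ℤ) :
    (s.setArr a i v).arr b j = if b = a ∧ j = i then v else s.arr b j := by
  by_cases h : b = a
  · subst h; simp [setArr, Function.update_apply]
  · simp [setArr, h]

@[simp] theorem setArr_used (s : State) (a i : ℕ) (v : ℤ) : (s.setArr a i v).used = s.used := rfl

end State

theorem bitLen_le_of_lt {z : ℤ} {Z : ℕ} (h : z.natAbs < 2 ^ Z) : bitLen z ≤ Z + 1 := by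
  have := Nat.size_le.2 h
  simp only [bitLen]; omega

theorem natAbs_lt_two_pow_bitLen (z : ℤ) : z.natAbs < 2 ^ bitLen z :=
  (Nat.lt_size_self _).trans (Nat.pow_lt_pow_right (by norm_num) (by simp [bitLen]))

/-! ### The test for solutions -/

/-- Some choice of entries `B i`, `1 ≤ i ≤ k`, for the variables of the equation with coefficients
`cs` makes the left-hand side equal to `-σ`. -/
def HasSol (B : ℕ → ℤ) (k : ℕ) : List ℤ → ℤ → Prop
  | [], σ => σ = 0
  | a :: cs, σ => ∃ i, 1 ≤ i ∧ i ≤ k ∧ HasSol B k cs (σ + a * B i)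

/-- Nested loops, one for each coefficient, that clear variable `11` if `HasSol` holds for array
`5` and the partial sum in variable `32 + 3 * l`. Variable `30 + 3 * l` is the counter of the loop
at level `l`; variables `2`, `3`, `4` hold `0`, `1`, `k`. -/
def solTest : List ℤ → ℕ → Cmd
  | [], l => .cond (32 + 3 * l) .skip (.seq (.arith 26 .sub 2 (32 + 3 * l))
      (.cond 26 .skip (.const 11 0)))
  | a :: cs, l => .seq (.arith (30 + 3 * l) .add 4 2) (.loop (30 + 3 * l)
      (.seq (.load 26 5 (30 + 3 * l)) (.seq (.const 27 a) (.seq (.arith 26 .mul 27 26)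
      (.seq (.arith (35 + 3 * l) .add (32 + 3 * l) 26) (.seq (solTest cs (l + 1))
      (.arith (30 + 3 * l) .sub (30 + 3 * l) 3)))))))

theorem solTest_vars (cs : List ℤ) (l : ℕ) : ∀ x ∈ (solTest cs l).vars,
    x = 11 ∨ x = 26 ∨ x = 27 ∨ x = 30 + 3 * l ∨ 33 + 3 * l ≤ x := by
  induction cs generalizing l with
  | nil => intro x; simp only [solTest, Cmd.vars, Set.mem_union, Set.mem_singleton_iff]; simp; omega
  | cons a cs ih =>
    intro x
    simp only [solTest, Cmd.vars, Set.mem_union, Set.mem_singleton_iff]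
    have := ih (l + 1) x
    intro h
    rcases h with h | h | h | h | h | h | h
    any_goals omega
    have := this h
    omega

theorem solTest_arrs (cs : List ℤ) (l : ℕ) : (solTest cs l).arrs = ∅ := by
  induction cs generalizing l with
  | nil => simp [solTest, Cmd.arrs]
  | cons a cs ih => simp [solTest, Cmd.arrs, ih]

theorem solTest_not_flips (cs : List ℤ) (l : ℕ) : ¬ (solTest cs l).Flips := by
  induction cs generalizing l with
  | nil => simp [solTest, Cmd.Flips]
  | cons a cs ih => simp [solTest, Cmd.Flips, ih]

open Classical in
/-- Correctness of `solTest`. The entries of the array are bounded by `V`, and `Y` bounds everything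
that is computed, so that by `hY` all operands have at most `Z` bits. -/
theorem solTest_wp {ω : ℕ → Bool} {Z : ℕ} {Y : ℤ} (hY : ∀ z : ℤ, |z| ≤ Y → bitLen z ≤ Z)
    {B : ℕ → ℤ} {k : ℕ} {V : ℤ} (hkZ : k ≤ Z) (hkY : k ≤ Y)
    (hB : ∀ i, 1 ≤ i → i ≤ k → |B i| ≤ V) (hV : V ≤ Y) (hY1 : 1 ≤ Y) :
    ∀ (cs : List ℤ) (l : ℕ) (σ : ℤ) (s : State), |σ| + (cs.map (|·|)).sum * V ≤ Y →
      (∀ a ∈ cs, bitLen a ≤ Z) →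
      (∀ i, 1 ≤ i → i ≤ k → s.arr 5 i = B i) → s.var 2 = 0 → s.var 3 = 1 → s.var 4 = k →
      s.var (32 + 3 * l) = σ →
      WP ω Z (solTest cs l) (fun s' => s'.var 11 = if HasSol B k cs σ then 0 else s.var 11) s := by
  intro cs
  induction cs with
  | nil =>
    intro l σ s hσ _ hs h2 h3 h4 hacc
    simp only [List.map_nil, List.sum_nil, zero_mul, add_zero] at hσ
    have hσ' : bitLen (s.var (32 + 3 * l)) ≤ Z := hY _ (by rw [hacc]; exact hσ)
    refine WP.cond hσ' (fun h => WP.skip ?_) (fun h => WP.seq (WP.arith (hY _ ?_) hσ' ?_))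
    · rw [if_neg (show ¬ HasSol B k [] σ from fun h' : σ = 0 => by omega)]
    · rw [h2]; simp; omega
    · refine WP.cond (hY _ ?_) (fun h' => WP.skip ?_) (fun h' => WP.const (hY _ ?_) ?_)
      · simp [h2, hacc, Op.eval]; exact hσ
      · rw [if_neg (show ¬ HasSol B k [] σ from ?_)]
        · simp
        · rintro (h₀ : σ = 0)
          simp [h2, hacc, Op.eval, h₀] at h'
      · simp; omega
      · simp [h2, hacc, Op.eval] at h' h
        rw [if_pos (show HasSol B k [] σ from le_antisymm h h')]
        simp
  | cons a cs ih =>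
    intro l σ s hσ ha hs h2 h3 h4 hacc
    simp only [List.map_cons, List.sum_cons] at hσ
    have hkbit : bitLen (k : ℤ) ≤ Z := hY _ (by simpa using hkY)
    have h0bit : bitLen 0 ≤ Z := hY _ (by simp; omega)
    have h1bit : bitLen 1 ≤ Z := hY _ (by simp; omega)
    refine WP.seq (WP.arith (by rwa [h4]) (by rwa [h2]) ?_)
    -- After `j` rounds the last `j` entries of the array have been tried for the first variable.
    refine WP.mono (WP.loop (N := k) (fun j s' => s'.var (30 + 3 * l) = (k - j : ℤ) ∧
      s'.var 11 = (if ∃ i, 1 ≤ i ∧ i ≤ k ∧ k < i + j ∧ HasSol B k cs (σ + a * B i) then 0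
        else s.var 11) ∧ s'.arr 5 = s.arr 5 ∧ s'.var 2 = 0 ∧ s'.var 3 = 1 ∧ s'.var 4 = k ∧
        s'.var (32 + 3 * l) = σ) hkZ ?_ ?_ ?_ ?_) ?_
    · refine ⟨by simp [h2, h4, Op.eval], ?_, by simp, ?_, ?_, ?_, by simp [hacc]⟩
      · rw [if_neg (by rintro ⟨i, -, h, h', -⟩; omega), State.setVar_var, if_neg (by omega)]
      · rw [State.setVar_var, if_neg (by omega), h2]
      · rw [State.setVar_var, if_neg (by omega), h3]
      · rw [State.setVar_var, if_neg (by omega), h4]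
    · rintro j s' hj ⟨hc, -⟩
      rw [hc]; exact hY _ (by rw [abs_of_nonneg] <;> omega)
    · rintro j s' hj ⟨hc, hok, harr, h2', h3', h4', hacc'⟩
      refine ⟨by omega, ?_⟩
      have hcbit : bitLen (s'.var (30 + 3 * l)) ≤ Z := by
        rw [hc]; exact hY _ (by rw [abs_of_nonneg] <;> omega)
      have hidx : s'.index (30 + 3 * l) = k - j := by simp only [State.index, hc]; omega
      have hBj := hB (k - j) (by omega) (by omega)
      have hload : s'.arr 5 (s'.index (30 + 3 * l)) = B (k - j) := by
        rw [hidx, harr, hs _ (by omega) (by omega)]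
      have hV0 : 0 ≤ V := (abs_nonneg _).trans hBj
      have hsum0 : 0 ≤ (cs.map (|·|)).sum := List.sum_nonneg (by simp)
      have habs : |a * B (k - j)| ≤ |a| * V := by
        rw [abs_mul]; exact mul_le_mul_of_nonneg_left hBj (abs_nonneg _)
      have hYa : |σ| + |a| * V + (cs.map (|·|)).sum * V ≤ Y := by linarith
      have hsumV := mul_nonneg hsum0 hV0
      have hσ0 := abs_nonneg σ
      have haV := mul_nonneg (abs_nonneg a) hV0
      have hBbit := hY (B (k - j)) (by linarith)
      refine WP.seq (WP.load hcbit (by rw [hload]; exact hBbit) ?_)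
      refine WP.seq (WP.const (ha a (by simp)) ?_)
      refine WP.seq (WP.arith (by simp; exact ha a (by simp)) (by simp [hload, hBbit]) ?_)
      have e1 : (32 + 3 * l = 26) = False := by simp; omega
      have e2 : (32 + 3 * l = 27) = False := by simp; omega
      have e3 : (30 + 3 * l = 26) = False := by simp; omega
      have e4 : (30 + 3 * l = 27) = False := by simp; omega
      have e5 : (32 + 3 * l = 35 + 3 * l) = False := by simp
      have e6 : (2 = 35 + 3 * l) = False := by simp; omega
      have e7 : (3 = 35 + 3 * l) = False := by simp; omega
      have e8 : (4 = 35 + 3 * l) = False := by simp; omega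
      have e9 : (11 = 35 + 3 * l) = False := by simp; omega
      have e10 : (30 + 3 * l = 35 + 3 * l) = False := by simp
      have e11 : (11 = 30 + 3 * l) = False := by simp; omega
      have e12 : (2 = 30 + 3 * l) = False := by simp; omega
      have e13 : (3 = 30 + 3 * l) = False := by simp; omega
      have e14 : (4 = 30 + 3 * l) = False := by simp; omega
      have e15 : (32 + 3 * l = 30 + 3 * l) = False := by simp
      refine WP.seq (WP.arith (by simp [e1, e2, hacc']; exact hY _ (by linarith))
        (by simp [hload, Op.eval]; exact hY _ (by linarith)) ?_)
      refine WP.seq ((ih (l + 1) (σ + a * B (k - j)) _ ?_ (fun b hb => ha b (by simp [hb]))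
        ?_ ?_ ?_ ?_ ?_).frame.mono ?_)
      · have := abs_add_le σ (a * B (k - j)); linarith
      · intro i hi hi'; simp [harr, hs i hi hi']
      · simp [e6, h2']
      · simp [e7, h3']
      · simp [e8, h4']
      · simp [show 32 + 3 * (l + 1) = 35 + 3 * l by ring, e1, e2, hload, hacc', Op.eval]
      · rintro s'' ⟨hok'', hv, harr'', -⟩
        have hv' : ∀ x, x ≠ 11 → x ≠ 26 → x ≠ 27 → x ≠ 33 + 3 * l → x < 36 + 3 * l →
            s''.var x = _ := fun x a1 a2 a3 a4 a5 => hv x (fun hx => by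
              have := solTest_vars cs (l + 1) x hx; omega)
        have hv30 := hv' (30 + 3 * l) (by omega) (by omega) (by omega) (by omega) (by omega)
        have hv2 := hv' 2 (by omega) (by omega) (by omega) (by omega) (by omega)
        have hv3 := hv' 3 (by omega) (by omega) (by omega) (by omega) (by omega)
        have hv4 := hv' 4 (by omega) (by omega) (by omega) (by omega) (by omega)
        have hv32 := hv' (32 + 3 * l) (by omega) (by omega) (by omega) (by omega) (by omega)
        have ha5 := harr'' 5 (by simp [solTest_arrs])
        simp [e1, e2, e3, e4, e6, e7, e8, e9] at hv30 hv2 hv3 hv4 hv32 ha5 hok''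
        refine WP.arith (by rwa [hv30]) (by rw [hv3, h3']; exact h1bit) ?_
        simp only [State.setVar_var, State.setVar_arr, Op.eval, e11, e12, e13, e14, e15, if_false,
          if_true, hv30, hv3, hc, h3', hok'', hok, ha5, harr, hv2, h2', hv4, h4', hv32, hacc',
          and_true]
        refine ⟨by push_cast; ring, ?_⟩
        by_cases hsol : HasSol B k cs (σ + a * B (k - j))
        · rw [if_pos hsol, if_pos ⟨k - j, by omega, by omega, by omega, hsol⟩]
        · rw [if_neg hsol]
          refine if_congr ?_ rfl rfl
          constructor
          · rintro ⟨i, h1, h2, h3, h4⟩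
            exact ⟨i, h1, h2, by omega, h4⟩
          · rintro ⟨i, h1, h2, h3, h4⟩
            refine ⟨i, h1, h2, ?_, h4⟩
            by_contra hlt
            obtain rfl : i = k - j := by omega
            exact hsol h4
    · rintro s' ⟨hc, -⟩; omega
    · rintro s' ⟨-, hok, -⟩
      rw [hok]
      refine if_congr ?_ rfl rfl
      simp only [HasSol]
      refine exists_congr fun i => ?_
      constructor
      · rintro ⟨h1, h2, -, h4⟩; exact ⟨h1, h2, h4⟩
      · rintro ⟨h1, h2, h4⟩; exact ⟨h1, h2, by omega, h4⟩

/-! ### Drawing a random subset -/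

/-- The number with binary digits `ω u, …, ω (u + m - 1)`, most significant first. -/
def readNat (ω : ℕ → Bool) (u : ℕ) : ℕ → ℕ
  | 0 => 0
  | m + 1 => 2 * readNat ω u m + (ω (u + m)).toNat

theorem readNat_lt (ω : ℕ → Bool) (u m : ℕ) : readNat ω u m < 2 ^ m := by
  induction m with
  | zero => simp [readNat]
  | succ m ih =>
    have := Bool.toNat_le (ω (u + m))
    rw [readNat, pow_succ]
    omega

/-- The `j`-th random position, `1 ≤ draw ≤ 2 ^ m`, read from the coins from `u` on. -/
def draw (ω : ℕ → Bool) (m u j : ℕ) : ℕ := readNat ω (u + j * m) m + 1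

/-- The position drawn before the `j`-th one; `0` if there is none. -/
def lastDraw (ω : ℕ → Bool) (m u : ℕ) : ℕ → ℕ
  | 0 => 0
  | j + 1 => draw ω m u j

/-- The first `k` draws are strictly increasing and stay below `len`. -/
def Increasing (ω : ℕ → Bool) (m u len k : ℕ) : Prop :=
  ∀ j < k, lastDraw ω m u j < draw ω m u j ∧ draw ω m u j < len

/-- The first `k` draws point, in increasing order, to entries of `w` among which the equation with
coefficients `cs` has no solution. -/
def Success (w : List ℤ) (cs : List ℤ) (k m : ℕ) (ω : ℕ → Bool) (u : ℕ) : Prop :=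
  Increasing ω m u w.length k ∧ ¬ HasSol (fun i => w.getD (draw ω m u (k - i)) 0) k cs 0

/-- Variable `22` receives a random number below the power of two in variable `8`, which the
doubling counter `23` reaches after as many rounds as there are digits. -/
def drawProg : Cmd :=
  .seq (.const 22 0) (.seq (.const 23 1) (.seq (.arith 24 .sub 8 23)
    (.loop 24 (.seq (.flip 25) (.seq (.arith 22 .add 22 22) (.seq (.arith 22 .add 22 25)
      (.seq (.arith 23 .add 23 23) (.arith 24 .sub 8 23))))))))

/-- One round of `pickProg`. -/
def pickStep : Cmd :=
  .seq drawProg (.seq (.arith 22 .add 22 3) (.seq (.arith 24 .sub 22 21)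
    (.seq (.cond 24 .skip (.const 11 0)) (.seq (.arith 24 .sub 0 22)
    (.seq (.cond 24 .skip (.const 11 0)) (.seq (.load 25 0 22) (.seq (.store 5 20 25)
    (.seq (.arith 21 .add 22 2) (.arith 20 .sub 20 3)))))))))

/-- Draws as many random positions as variable `20` says, stores the entries of array `0` found
there in array `5`, and clears variable `11` unless the positions are increasing and in range. The
number of coins tossed is the same in all cases. Position `0` of array `0`, which holds `k`, is
never drawn. -/
def pickProg : Cmd := .loop 20 pickStep

/-- One sample: variable `11` becomes `1` or `0` according to `Success`. -/
def sampleProg (cs : List ℤ) : Cmd :=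
  .seq (.const 11 1) (.seq (.const 21 0) (.seq (.arith 20 .add 4 2) (.seq pickProg
    (.seq (.const 32 0) (solTest cs 0)))))

/-- As many samples as variable `7` says; variable `10` counts the successes. -/
def sampleLoop (cs : List ℤ) : Cmd :=
  .seq (.arith 12 .add 7 2) (.loop 12
    (.seq (sampleProg cs) (.seq (.arith 10 .add 10 11) (.arith 12 .sub 12 3))))

section

variable {ω : ℕ → Bool} {Z : ℕ} {Y : ℤ}

theorem drawProg_wp (hY : ∀ z : ℤ, |z| ≤ Y → bitLen z ≤ Z) {m : ℕ} (hm : m ≤ Z)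
    (hM : 2 * 2 ^ m ≤ Y) (s : State) (h8 : s.var 8 = 2 ^ m) :
    WP ω Z drawProg (fun s' => s'.var 22 = readNat ω s.used m ∧ s'.used = s.used + m) s := by
  have hM1 : (1 : ℤ) ≤ 2 ^ m := one_le_pow₀ (by norm_num)
  have hbM : bitLen (2 ^ m) ≤ Z := hY _ (by rw [abs_of_pos] <;> omega)
  have hb1 : bitLen 1 ≤ Z := hY _ (by rw [abs_one]; omega)
  have hb0 : bitLen 0 ≤ Z := hY _ (by rw [abs_zero]; omega)
  refine WP.seq (WP.const hb0 (WP.seq (WP.const hb1 (WP.seq (WP.arith ?_ ?_ ?_)))))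
  · simpa [h8] using hbM
  · simpa using hb1
  refine WP.mono (WP.loop (N := m) (fun i s' => s'.var 8 = 2 ^ m ∧ s'.var 23 = 2 ^ i ∧
    s'.var 24 = 2 ^ m - 2 ^ i ∧ s'.var 22 = readNat ω s.used i ∧ s'.used = s.used + i)
    hm ?_ ?_ ?_ ?_) ?_
  · simp [h8, Op.eval, readNat]
  · rintro i s' hi ⟨-, -, h24, -⟩
    have : (2 : ℤ) ^ i ≤ 2 ^ m := pow_le_pow_right₀ (by norm_num) hi
    have : (0 : ℤ) < 2 ^ i := by positivity
    rw [h24]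
    exact hY _ (by rw [abs_of_nonneg] <;> omega)
  · rintro i s' hi ⟨h8', h23, h24, h22, hu⟩
    have h2 : (2 : ℤ) ^ (i + 1) ≤ 2 ^ m := pow_le_pow_right₀ (by norm_num) hi
    have h1 : (0 : ℤ) < 2 ^ i := by positivity
    rw [pow_succ] at h2
    have hr : (readNat ω s.used i : ℤ) < 2 ^ i := by exact_mod_cast readNat_lt ω s.used i
    refine ⟨by omega, ?_⟩
    have hflip : ((if ω s'.used then 1 else 0 : ℤ)) = ((ω (s.used + i)).toNat : ℤ) := by
      rw [hu]; cases ω (s.used + i) <;> simp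
    have hle : ((ω (s.used + i)).toNat : ℤ) ≤ 1 := by exact_mod_cast Bool.toNat_le _
    refine WP.seq (WP.flip ?_)
    refine WP.seq (WP.arith ?_ ?_ ?_)
    · simp [h22]; exact hY _ (by rw [abs_of_nonneg] <;> omega)
    · simp [h22]; exact hY _ (by rw [abs_of_nonneg] <;> omega)
    refine WP.seq (WP.arith ?_ ?_ ?_)
    · simp [h22, Op.eval]; exact hY _ (by rw [abs_of_nonneg] <;> omega)
    · simp only [State.setVar_var]
      simp only [Nat.reduceEqDiff, if_true, if_false, hflip]
      exact hY _ (by rw [abs_of_nonneg] <;> omega)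
    refine WP.seq (WP.arith ?_ ?_ (WP.arith ?_ ?_ ?_))
    · simp [h23]; exact hY _ (by rw [abs_of_nonneg] <;> omega)
    · simp [h23]; exact hY _ (by rw [abs_of_nonneg] <;> omega)
    · simp [h8', hbM]
    · simp [h23, Op.eval]; exact hY _ (by rw [abs_of_nonneg] <;> omega)
    · simp only [State.setVar_var, Nat.reduceEqDiff, if_true, if_false, h8', h22, h23,
        Op.eval, State.setVar_used, hu]
      refine ⟨trivial, by ring, by ring, ?_, by ring⟩
      rw [readNat, Nat.cast_add, ← hflip, hu]; push_cast; ring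
  · rintro s' ⟨-, -, h24, -⟩; simp [h24]
  · rintro s' ⟨-, -, -, h22, hu⟩; exact ⟨h22, hu⟩

theorem drawProg_vars : drawProg.vars = {22, 23, 24, 25} := by
  ext x; simp [drawProg, Cmd.vars]; tauto

theorem drawProg_arrs : drawProg.arrs = ∅ := by simp [drawProg, Cmd.arrs]

theorem pickProg_vars : pickProg.vars = {11, 20, 21, 22, 23, 24, 25} := by
  ext x; simp [pickProg, pickStep, Cmd.vars, drawProg_vars]; tauto

theorem pickProg_arrs : pickProg.arrs = {5} := by
  simp [pickProg, pickStep, Cmd.arrs, drawProg_arrs]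

open Classical in
theorem pickProg_wp (hY : ∀ z : ℤ, |z| ≤ Y → bitLen z ≤ Z) {w : List ℤ} {k m : ℕ} (hm : m ≤ Z)
    (hk : k ≤ Z) (hkY : k ≤ Y) (hM : 2 * 2 ^ m ≤ Y) (hlen : (w.length : ℤ) ≤ Y)
    (hw : ∀ i, |w.getD i 0| ≤ Y) (s : State) (h0 : s.var 0 = w.length)
    (ha0 : ∀ i, s.arr 0 i = w.getD i 0) (h2 : s.var 2 = 0) (h3 : s.var 3 = 1)
    (h8 : s.var 8 = 2 ^ m) (h11 : s.var 11 = 1) (h20 : s.var 20 = k) (h21 : s.var 21 = 0) :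
    WP ω Z pickProg (fun s' =>
      s'.var 11 = (if Increasing ω m s.used w.length k then 1 else 0) ∧
      (∀ i, 1 ≤ i → i ≤ k → s'.arr 5 i = w.getD (draw ω m s.used (k - i)) 0) ∧
      s'.used = s.used + k * m) s := by
  have hM1 : (1 : ℤ) ≤ 2 ^ m := one_le_pow₀ (by norm_num)
  have hb1 : bitLen 1 ≤ Z := hY _ (by rw [abs_one]; omega)
  have hb0 : bitLen 0 ≤ Z := hY _ (by rw [abs_zero]; omega)
  have hblen : bitLen (w.length : ℤ) ≤ Z := hY _ (by rw [abs_of_nonneg] <;> omega)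
  have hdraw : ∀ j, (draw ω m s.used j : ℤ) ≤ 2 ^ m := fun j => by
    exact_mod_cast readNat_lt ω (s.used + j * m) m
  have hlast : ∀ j, (lastDraw ω m s.used j : ℤ) ≤ 2 ^ m := fun j => by
    cases j with
    | zero => simp [lastDraw]
    | succ j => exact hdraw j
  -- Array `5` is filled from index `k` downwards, since the loop counter serves as the index.
  refine WP.mono (WP.loop (N := k) (fun j s' => s'.var 0 = w.length ∧
    (∀ i, s'.arr 0 i = w.getD i 0) ∧ s'.var 2 = 0 ∧ s'.var 3 = 1 ∧ s'.var 8 = 2 ^ m ∧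
    s'.var 20 = (k - j : ℤ) ∧ s'.var 21 = lastDraw ω m s.used j ∧ s'.used = s.used + j * m ∧
    s'.var 11 = (if Increasing ω m s.used w.length j then 1 else 0) ∧
    (∀ i, i ≤ k → k < i + j → s'.arr 5 i = w.getD (draw ω m s.used (k - i)) 0)) hk ?_ ?_ ?_ ?_) ?_
  · refine ⟨h0, ha0, h2, h3, h8, by simp [h20], by simp [h21, lastDraw], by simp, ?_, ?_⟩
    · rw [h11, if_pos]; intro j hj; omega
    · intro i; omega
  · rintro j s' hj ⟨-, -, -, -, -, h20', -⟩
    rw [h20']; exact hY _ (by rw [abs_of_nonneg] <;> omega)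
  · rintro j s' hj ⟨h0', ha0', h2', h3', h8', h20', h21', hu, h11', hB⟩
    refine ⟨by omega, WP.seq ((drawProg_wp hY hm hM s' h8').frame.mono ?_)⟩
    rintro s'' ⟨⟨h22, hu''⟩, hv, ha, -⟩
    rw [drawProg_vars] at hv
    rw [drawProg_arrs] at ha
    simp only [Set.mem_insert_iff, Set.mem_singleton_iff, Set.mem_empty_iff_false, not_or,
      not_false_eq_true, forall_const] at hv ha
    have v0 : s''.var 0 = w.length := by rw [hv 0 (by simp), h0']
    have v2 : s''.var 2 = 0 := by rw [hv 2 (by simp), h2']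
    have v3 : s''.var 3 = 1 := by rw [hv 3 (by simp), h3']
    have v8 : s''.var 8 = 2 ^ m := by rw [hv 8 (by simp), h8']
    have v11 := (hv 11 (by simp)).trans h11'
    have v20 := (hv 20 (by simp)).trans h20'
    have v21 := (hv 21 (by simp)).trans h21'
    have v22 : s''.var 22 + 1 = (draw ω m s.used j : ℤ) := by
      rw [h22, hu, draw]; push_cast; ring
    have hd := hdraw j
    have hd1 : (1 : ℤ) ≤ draw ω m s.used j := by exact_mod_cast Nat.le_add_left _ _
    have hl := hlast j
    have hbd : bitLen (draw ω m s.used j : ℤ) ≤ Z := hY _ (by rw [abs_of_nonneg] <;> omega)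
    have hb22 : bitLen (s''.var 22) ≤ Z := hY _ (by rw [abs_of_nonneg] <;> omega)
    have hbl : bitLen (lastDraw ω m s.used j : ℤ) ≤ Z := hY _ (by rw [abs_of_nonneg] <;> omega)
    have hbk : bitLen (k - j : ℤ) ≤ Z := hY _ (by rw [abs_of_nonneg] <;> omega)
    have hbw := fun i => hY _ (hw i)
    have hsub : ∀ x y : ℤ, 0 ≤ x → x ≤ Y → 0 ≤ y → y ≤ Y → bitLen (x - y) ≤ Z :=
      fun x y _ _ _ _ => hY _ (by rw [abs_le]; omega)
    refine WP.seq (WP.arith hb22 (by rwa [v3]) ?_)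
    refine WP.seq (WP.arith (by simpa [Op.eval, v3, v22] using hbd) (by simpa [v21] using hbl) ?_)
    -- The flag survives both comparisons exactly if the new position is in order and in range.
    suffices H : ∀ s₁ : State, (∀ x, x ≠ 11 → x ≠ 24 → s₁.var x = if x = 22 then
        (draw ω m s.used j : ℤ) else s''.var x) → s₁.arr = s''.arr → s₁.used = s''.used →
        s₁.var 11 = (if Increasing ω m s.used w.length (j + 1) then 1 else 0) →
        WP ω Z (.seq (.load 25 0 22) (.seq (.store 5 20 25)
          (.seq (.arith 21 .add 22 2) (.arith 20 .sub 20 3)))) (fun s' => s'.var 0 = w.length ∧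
          (∀ i, s'.arr 0 i = w.getD i 0) ∧ s'.var 2 = 0 ∧ s'.var 3 = 1 ∧ s'.var 8 = 2 ^ m ∧
          s'.var 20 = (k - (j + 1 : ℕ) : ℤ) ∧ s'.var 21 = lastDraw ω m s.used (j + 1) ∧
          s'.used = s.used + (j + 1) * m ∧
          s'.var 11 = (if Increasing ω m s.used w.length (j + 1) then 1 else 0) ∧
          (∀ i, i ≤ k → k < i + (j + 1) → s'.arr 5 i = w.getD (draw ω m s.used (k - i)) 0)) s₁ by
      have hinc : Increasing ω m s.used w.length (j + 1) ↔ Increasing ω m s.used w.length j ∧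
          lastDraw ω m s.used j < draw ω m s.used j ∧ draw ω m s.used j < w.length :=
        Nat.forall_lt_succ_right
      have hif : ∀ {a : ℕ}, (0 < (a : ℤ)) ↔ 0 < a := by simp
      refine WP.seq (WP.cond ?_ (fun h => WP.skip ?_) (fun h => WP.const hb0 ?_))
      · simp only [State.setVar_var, Nat.reduceEqDiff, if_true, if_false, Op.eval, v3, v22, v21]
        exact hsub _ _ (by omega) (by omega) (by omega) (by omega)
      · refine WP.seq (WP.arith (by simpa [v0] using hblen)
          (by simpa [v3, v22, Op.eval] using hbd) (WP.seq (WP.cond ?_ (fun h' => WP.skip ?_)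
          (fun h' => WP.const hb0 ?_))))
        · simp only [State.setVar_var, Nat.reduceEqDiff, if_true, if_false, Op.eval, v3, v22, v0]
          exact hsub _ _ (by omega) (by omega) (by omega) (by omega)
        · simp only [State.setVar_var, Nat.reduceEqDiff, if_true, if_false, Op.eval, v3, v22, v0,
            v21, OfNat.zero_ne_ofNat] at h h'
          refine H _ ?_ (by simp) (by simp) ?_
          · intro x hx1 hx2; simp [hx2, Op.eval, v3, v22]
          · simp only [State.setVar_var, Nat.reduceEqDiff, if_false, v11]
            refine if_congr ?_ rfl rfl
            rw [hinc]
            exact ⟨fun h₁ => ⟨h₁, by omega, by omega⟩, fun h₁ => h₁.1⟩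
        · simp only [State.setVar_var, Nat.reduceEqDiff, if_true, if_false, Op.eval, v3, v22, v0,
            v21, OfNat.zero_ne_ofNat] at h h'
          refine H _ ?_ (by simp) (by simp) ?_
          · intro x hx1 hx2; simp [hx1, hx2, Op.eval, v3, v22]
          · rw [if_neg (by rw [hinc]; omega)]; simp
      · simp only [State.setVar_var, Nat.reduceEqDiff, if_true, if_false, Op.eval, v3, v22,
          v21] at h
        refine WP.seq (WP.arith (by simpa [v0] using hblen)
          (by simpa [v3, v22, Op.eval] using hbd) (WP.seq (WP.cond ?_ (fun h' => WP.skip ?_)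
          (fun h' => WP.const hb0 ?_))))
        · simp only [State.setVar_var, Nat.reduceEqDiff, if_true, if_false, Op.eval, v3, v22, v0,
            OfNat.zero_ne_ofNat]
          exact hsub _ _ (by omega) (by omega) (by omega) (by omega)
        all_goals
          refine H _ ?_ (by simp) (by simp) ?_
          · intro x hx1 hx2; simp [hx1, hx2, Op.eval, v3, v22]
          · rw [if_neg (by rw [hinc]; omega)]; simp
    intro s₁ hv₁ ha₁ hu₁ hf₁
    have idx22 : s₁.index 22 = draw ω m s.used j := by
      simp [State.index, hv₁ 22 (by simp) (by simp)]
    have idx20 : s₁.index 20 = k - j := by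
      simp only [State.index, hv₁ 20 (by simp) (by simp), Nat.reduceEqDiff, if_false, v20]; omega
    have w22 : s₁.var 22 = draw ω m s.used j := by simp [hv₁ 22 (by simp) (by simp)]
    have w20 : s₁.var 20 = k - j := by simp [hv₁ 20 (by simp) (by simp), v20]
    have w0 : s₁.var 0 = w.length := by simp [hv₁ 0 (by simp) (by simp), v0]
    have w2 : s₁.var 2 = 0 := by simp [hv₁ 2 (by simp) (by simp), v2]
    have w3 : s₁.var 3 = 1 := by simp [hv₁ 3 (by simp) (by simp), v3]
    have w8 : s₁.var 8 = 2 ^ m := by simp [hv₁ 8 (by simp) (by simp), v8]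
    have hld : s₁.arr 0 (s₁.index 22) = w.getD (draw ω m s.used j) 0 := by
      rw [ha₁, idx22, ha 0, ha0']
    refine WP.seq (WP.load (by rwa [w22]) (by rw [hld]; exact hbw _) ?_)
    refine WP.seq (WP.store (by simpa [w20] using hbk) (by simpa [hld] using hbw _) ?_)
    refine WP.seq (WP.arith (by simpa [w22] using hbd) (by simpa [w2] using hb0) ?_)
    refine WP.arith (by simpa [w20] using hbk) (by simpa [w3] using hb1) ?_
    have idx20' : ∀ v, (s₁.setVar 25 v).index 20 = k - j := fun v => by
      rw [← idx20]; simp [State.index]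
    simp only [State.setVar_var, State.setVar_arr, State.setVar_used, State.setArr_var,
      State.setArr_arr, State.setArr_used, Nat.reduceEqDiff, OfNat.zero_ne_ofNat, if_true, if_false,
      false_and, true_and, Op.eval, w0, w2, w3, w8, w20, w22, hld, hf₁, hu₁, hu'', hu, ha₁, ha,
      ha0', add_zero, lastDraw, idx20', implies_true]
    refine ⟨by push_cast; ring, by ring, ?_⟩
    intro i hi hij
    by_cases hik : i = k - j
    · subst hik; rw [if_pos rfl, show k - (k - j) = j by omega]
    · rw [if_neg hik, hB i hi (by omega)]
  · rintro s' ⟨-, -, -, -, -, h20', -⟩; simp [h20']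
  · rintro s' ⟨-, -, -, -, -, -, -, hu, h11', hB⟩
    exact ⟨h11', fun i h1 hi => hB i hi (by omega), hu⟩

open Classical in
theorem sampleProg_wp (hY : ∀ z : ℤ, |z| ≤ Y → bitLen z ≤ Z) {w cs : List ℤ} {k m : ℕ} {V : ℤ}
    (hm : m ≤ Z) (hk : k ≤ Z) (hkY : k ≤ Y) (hM : 2 * 2 ^ m ≤ Y) (hlen : (w.length : ℤ) ≤ Y)
    (hw : ∀ i, |w.getD i 0| ≤ V) (hV : V ≤ Y) (hcs : (cs.map (|·|)).sum * V ≤ Y)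
    (hcb : ∀ a ∈ cs, bitLen a ≤ Z) (s : State) (h0 : s.var 0 = w.length)
    (ha0 : ∀ i, s.arr 0 i = w.getD i 0) (h2 : s.var 2 = 0) (h3 : s.var 3 = 1) (h4 : s.var 4 = k)
    (h8 : s.var 8 = 2 ^ m) :
    WP ω Z (sampleProg cs) (fun s' =>
      s'.var 11 = (if Success w cs k m ω s.used then 1 else 0) ∧ s'.used = s.used + k * m) s := by
  have hM1 : (1 : ℤ) ≤ 2 ^ m := one_le_pow₀ (by norm_num)
  have hb1 : bitLen 1 ≤ Z := hY _ (by rw [abs_one]; omega)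
  have hb0 : bitLen 0 ≤ Z := hY _ (by rw [abs_zero]; omega)
  have hbk : bitLen (k : ℤ) ≤ Z := hY _ (by rw [abs_of_nonneg] <;> omega)
  refine WP.seq (WP.const hb1 (WP.seq (WP.const hb0 (WP.seq (WP.arith ?_ ?_ ?_)))))
  · simpa [h4] using hbk
  · simpa [h2] using hb0
  refine WP.seq ((pickProg_wp hY hm hk hkY hM hlen (fun i => (hw i).trans hV) _ ?_ ?_ ?_ ?_ ?_ ?_ ?_
    ?_).frame.mono ?_)
  any_goals simp [h0, ha0, h2, h3, h4, h8, Op.eval]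
  rintro s' h11 hB hu hv - -
  simp only [pickProg_vars, Set.mem_insert_iff, Set.mem_singleton_iff, not_or] at hv
  refine WP.seq (WP.const hb0 ((solTest_wp hY hk hkY (V := V)
    (B := fun i => w.getD (draw ω m s.used (k - i)) 0) (fun i _ _ => hw _) hV
    (by omega) cs 0 0 _ ?_ hcb ?_ ?_ ?_ ?_ ?_).frame.mono ?_))
  · simpa using hcs
  · simpa using hB
  · simp [hv 2, h2]
  · simp [hv 3, h3]
  · simp [hv 4, h4]
  · simp
  · rintro s'' ⟨hr, -, -, hu''⟩
    refine ⟨?_, by rw [hu'' (solTest_not_flips _ _)]; simpa using hu⟩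
    rw [hr]
    simp only [State.setVar_var, Nat.reduceEqDiff, if_false, h11, Success]
    split_ifs <;> simp_all

theorem sampleProg_vars (cs : List ℤ) : ∀ x ∈ (sampleProg cs).vars,
    x = 11 ∨ 20 ≤ x := by
  intro x
  have := solTest_vars cs 0 x
  simp only [sampleProg, Cmd.vars, pickProg_vars, Set.mem_union, Set.mem_insert_iff,
    Set.mem_singleton_iff]
  intro h
  rcases h with h | h | h | h | h | h
  any_goals omega
  have := this h
  omega

theorem sampleProg_arrs (cs : List ℤ) : (sampleProg cs).arrs = {5} := by
  simp [sampleProg, Cmd.arrs, pickProg_arrs, solTest_arrs]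

open Classical in
theorem sampleLoop_wp (hY : ∀ z : ℤ, |z| ≤ Y → bitLen z ≤ Z) {w cs : List ℤ} {k m T : ℕ} {V : ℤ}
    (hm : m ≤ Z) (hk : k ≤ Z) (hT : T ≤ Z) (hkY : k ≤ Y) (hTY : T ≤ Y) (hM : 2 * 2 ^ m ≤ Y)
    (hlen : (w.length : ℤ) ≤ Y) (hw : ∀ i, |w.getD i 0| ≤ V) (hV : V ≤ Y)
    (hcs : (cs.map (|·|)).sum * V ≤ Y) (hcb : ∀ a ∈ cs, bitLen a ≤ Z)
    (s : State) (h0 : s.var 0 = w.length) (ha0 : ∀ i, s.arr 0 i = w.getD i 0) (h2 : s.var 2 = 0)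
    (h3 : s.var 3 = 1) (h4 : s.var 4 = k) (h7 : s.var 7 = T) (h8 : s.var 8 = 2 ^ m)
    (h10 : s.var 10 = 0) (hu : s.used = 0) :
    WP ω Z (sampleLoop cs) (fun s' => s'.var 10 =
      ∑ i ∈ Finset.range T, if Success w cs k m ω (i * (k * m)) then 1 else 0) s := by
  have hM1 : (1 : ℤ) ≤ 2 ^ m := one_le_pow₀ (by norm_num)
  have hb1 : bitLen 1 ≤ Z := hY _ (by rw [abs_one]; omega)
  have hb0 : bitLen 0 ≤ Z := hY _ (by rw [abs_zero]; omega)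
  have hbT : bitLen (T : ℤ) ≤ Z := hY _ (by rw [abs_of_nonneg] <;> omega)
  refine WP.seq (WP.arith (by rwa [h7]) (by rwa [h2]) ?_)
  refine WP.mono (WP.loop (N := T) (fun i s' => s'.var 0 = w.length ∧
    (∀ i, s'.arr 0 i = w.getD i 0) ∧ s'.var 2 = 0 ∧ s'.var 3 = 1 ∧ s'.var 4 = k ∧
    s'.var 8 = 2 ^ m ∧ s'.var 12 = (T - i : ℤ) ∧ s'.used = i * (k * m) ∧ s'.var 10 =
      ∑ i ∈ Finset.range i, if Success w cs k m ω (i * (k * m)) then 1 else 0) hT ?_ ?_ ?_ ?_) ?_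
  · simp [h0, ha0, h2, h3, h4, h7, h8, h10, hu, Op.eval]
  · rintro i s' hi ⟨-, -, -, -, -, -, h12, -⟩
    rw [h12]; exact hY _ (by rw [abs_of_nonneg] <;> omega)
  · rintro i s' hi ⟨h0', ha0', h2', h3', h4', h8', h12, hu', h10'⟩
    refine ⟨by omega, WP.seq ((sampleProg_wp hY hm hk hkY hM hlen hw hV hcs hcb s' h0' ha0' h2' h3'
      h4' h8').frame.mono ?_)⟩
    rintro s'' ⟨⟨h11, hu''⟩, hv, ha, -⟩
    have hv' : ∀ x, x ≠ 11 → x < 20 → s''.var x = s'.var x := fun x h1 h2 => hv x fun hx => by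
      have := sampleProg_vars cs x hx; omega
    have ha' := ha 0 (by simp [sampleProg_arrs])
    have hsum : ∀ j, j ≤ T → 0 ≤ (∑ i ∈ Finset.range j,
        if Success w cs k m ω (i * (k * m)) then (1 : ℤ) else 0) ∧ (∑ i ∈ Finset.range j,
        if Success w cs k m ω (i * (k * m)) then (1 : ℤ) else 0) ≤ Y := by
      intro j hj
      refine ⟨Finset.sum_nonneg fun i _ => by split_ifs <;> simp, ?_⟩
      calc _ ≤ ∑ i ∈ Finset.range j, (1 : ℤ) :=
            Finset.sum_le_sum fun i _ => by split_ifs <;> simp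
        _ ≤ Y := by simp; omega
    have h10b : bitLen (s'.var 10) ≤ Z := by
      rw [h10']
      have := hsum i (by omega)
      exact hY _ (by rw [abs_of_nonneg] <;> omega)
    refine WP.seq (WP.arith (by rwa [hv' 10 (by simp) (by simp)])
      (by rw [h11]; split_ifs <;> assumption) ?_)
    refine WP.arith ?_ ?_ ?_
    · simp only [State.setVar_var, Nat.reduceEqDiff, if_false, hv' 12 (by simp) (by simp), h12]
      exact hY _ (by rw [abs_of_nonneg] <;> omega)
    · simpa [hv' 3, h3'] using hb1
    · refine ⟨?_, ?_, ?_, ?_, ?_, ?_, ?_, ?_, ?_⟩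
      · simp [hv' 0, h0']
      · simp [ha', ha0']
      · simp [hv' 2, h2']
      · simp [hv' 3, h3']
      · simp [hv' 4, h4']
      · simp [hv' 8, h8']
      · simp [hv' 12, hv' 3, h12, h3', Op.eval]; ring
      · simp [hu'', hu']; ring
      · rw [Finset.sum_range_succ, ← hu', ← h10', ← h11]
        simp [hv' 10, Op.eval]
  · rintro s' ⟨-, -, -, -, -, -, h12, -⟩; simp [h12]
  · rintro s' ⟨-, -, -, -, -, -, -, -, h⟩; exact h

end

/-! ### The algorithm -/

/-- Variable `x` becomes the `c`-th power of variable `y`, the exponent being in variable `c`. -/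
def powProg (x y c : ℕ) : Cmd :=
  .seq (.const x 1) (.seq (.arith 15 .add c 2) (.loop 15
    (.seq (.arith x .mul x y) (.arith 15 .sub 15 3))))

/-- Variable `x` becomes the number of digits in array `a` up to and including the first `1`. -/
def scanProg (a x : ℕ) : Cmd :=
  .seq (.const x 0) (.seq (.const 15 1) (.loop 15
    (.seq (.load 16 a x) (.seq (.arith x .add x 3) (.arith 15 .sub 3 16)))))

/-- Variable `8` becomes the least power of two that is at least variable `0` minus one. -/
def sizeProg : Cmd :=
  .seq (.const 8 1) (.seq (.arith 13 .sub 0 3) (.seq (.arith 15 .sub 13 8) (.loop 15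
    (.seq (.arith 8 .add 8 8) (.arith 15 .sub 13 8)))))

/-- Variable `7` becomes the number `(E * D) ^ 2 * G` of samples. Here `E` is `2` to the power of
the number of leading digits of `ε` read, `G` is one more than the number of leading digits of `δ` read,
`D = (C * k * k) ^ k`, and `k`, the first entry of array `0`, is copied to variable `4`. -/
def countProg (C : ℕ) : Cmd :=
  .seq (scanProg 1 14) (.seq (.const 17 2) (.seq (powProg 5 17 14) (.seq (scanProg 3 6)
    (.seq (.arith 6 .add 6 3) (.seq (.const 14 0) (.seq (.load 4 0 14) (.seq (.const 17 C)
    (.seq (.arith 17 .mul 17 4) (.seq (.arith 17 .mul 17 4) (.seq (powProg 18 17 4)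
    (.seq (.arith 5 .mul 5 18) (.seq (.arith 5 .mul 5 5) (.arith 7 .mul 5 6)))))))))))))

/-- The randomised approximation algorithm for the equation with coefficients `cs`. The variables
`1` and `2` initially hold the lengths of the digit arrays, which the running time must not depend
on, so they are overwritten without having been read. In the main part, the variables `2`, `3` hold
the constants `0`, `1`; variable `4` holds `k`, `7` the number of samples, `8` the range `2 ^ m` of
the random numbers, `9` the number `(2 ^ m) ^ k` of all tuples, `10` the number of successes so
far, and `11` tells whether the current sample is a success. -/
def approxProg (cs : List ℤ) (C : ℕ) : Cmd :=
  .seq (.const 2 0) (.seq (.const 3 1) (.seq (countProg C) (.seq sizeProg (.seq (powProg 9 8 4)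
    (.seq (.const 10 0) (.seq (sampleLoop cs) (.seq (.arith 0 .mul 10 9) (.arith 1 .add 7 2))))))))

section

variable {ω : ℕ → Bool} {Z : ℕ} {Y : ℤ}

theorem powProg_wp (hY : ∀ z : ℤ, |z| ≤ Y → bitLen z ≤ Z) {x y c : ℕ} (hx : 3 < x) (hx15 : x ≠ 15)
    (hxy : x ≠ y) (hy : y ≠ 15) (hcx : c ≠ x) {b N : ℕ} (hN : N ≤ Z) (hNY : N ≤ Y)
    (hbY : b ≤ Y) (hY1 : 1 ≤ Y) (hb : ∀ i ≤ N, ((b ^ i : ℕ) : ℤ) ≤ Y) (s : State)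
    (h2 : s.var 2 = 0) (h3 : s.var 3 = 1) (hys : s.var y = b) (hcs : s.var c = N) :
    WP ω Z (powProg x y c) (fun s' => s'.var x = (b ^ N : ℕ)) s := by
  have hnat : ∀ a : ℕ, (a : ℤ) ≤ Y → bitLen (a : ℤ) ≤ Z := fun a ha => hY _ (by simpa using ha)
  have hb1 : bitLen 1 ≤ Z := by simpa using hnat 1 (by simpa using hY1)
  have hb0 : bitLen 0 ≤ Z := by simpa using hnat 0 (by simp; omega)
  have x2 : 2 ≠ x := by omega
  have x3 : 3 ≠ x := by omega
  have x15 : 15 ≠ x := by omega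
  refine WP.seq (WP.const hb1 (WP.seq (WP.arith (by simpa [hcx, hcs] using hnat N hNY)
    (by simpa [x2, h2] using hb0) ?_)))
  refine WP.mono (WP.loop (N := N) (fun i s' => s'.var 3 = 1 ∧ s'.var y = b ∧
    s'.var 15 = (N - i : ℤ) ∧ s'.var x = (b ^ i : ℕ)) hN ?_ ?_ ?_ ?_) ?_
  · simp [hcx, hcs, hys, hy, hx15, hxy.symm, Op.eval, h2, h3, x2, x3]
  · rintro i s' hi ⟨-, -, h15, -⟩
    rw [h15]; exact hY _ (by rw [abs_of_nonneg] <;> omega)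
  · rintro i s' hi ⟨h3', hy', h15, hx'⟩
    refine ⟨by omega, WP.seq (WP.arith (by rw [hx']; exact hnat _ (hb i hi.le))
      (by rw [hy']; exact hnat _ hbY) (WP.arith ?_ ?_ ?_))⟩
    · simp only [State.setVar_var, x15, if_false, h15]
      exact hY _ (by rw [abs_of_nonneg] <;> omega)
    · simpa [x3, h3'] using hb1
    · simp [x3, x15, h3', hy, hy', hxy.symm, h15, hx15, hx', Op.eval, pow_succ]; ring
  · rintro s' ⟨-, -, h15, -⟩; simp [h15]
  · rintro s' ⟨-, -, -, h⟩; exact h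

theorem powProg_vars (x y c : ℕ) : (powProg x y c).vars = {x, 15} := by
  ext z; simp [powProg, Cmd.vars]; tauto

theorem powProg_arrs (x y c : ℕ) : (powProg x y c).arrs = ∅ := by simp [powProg, Cmd.arrs]

theorem scanProg_wp (hY : ∀ z : ℤ, |z| ≤ Y → bitLen z ≤ Z) {a x j : ℕ} (hx : 3 < x)
    (hx15 : x ≠ 15) (hx16 : x ≠ 16) (hj : j + 1 ≤ Z) (hjY : ((j + 1 : ℕ) : ℤ) ≤ Y) (s : State)
    (h3 : s.var 3 = 1) (hlt : ∀ i < j, s.arr a i = 0) (heq : s.arr a j = 1) :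
    WP ω Z (scanProg a x) (fun s' => s'.var x = (j + 1 : ℕ)) s := by
  have hnat : ∀ b : ℕ, b ≤ j + 1 → bitLen (b : ℤ) ≤ Z := fun a ha => hY _ (by simp; omega)
  have hb1 : bitLen 1 ≤ Z := by simpa using hnat 1 (by omega)
  have hb0 : bitLen 0 ≤ Z := by simpa using hnat 0 (by omega)
  have x3 : 3 ≠ x := by omega
  have x15 : 15 ≠ x := by omega
  have x16 : 16 ≠ x := by omega
  refine WP.seq (WP.const hb0 (WP.seq (WP.const hb1 ?_)))
  refine WP.mono (WP.loop (N := j + 1) (fun i s' => s'.var 3 = 1 ∧ s'.arr a = s.arr a ∧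
    s'.var 15 = (if i = j + 1 then 0 else 1) ∧ s'.var x = (i : ℕ)) hj ?_ ?_ ?_ ?_) ?_
  · simp [x3, hx15, h3]
  · rintro i s' hi ⟨-, -, h15, -⟩
    rw [h15]; split_ifs <;> assumption
  · rintro i s' hi ⟨h3', harr, h15, hx'⟩
    have hidx : s'.index x = i := by simp [State.index, hx']
    have hval : s'.arr a (s'.index x) = if i = j then 1 else 0 := by
      rw [hidx, harr]
      split_ifs with h
      · rw [h, heq]
      · exact hlt i (by omega)
    refine ⟨by rw [h15, if_neg (by omega)]; simp, ?_⟩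
    refine WP.seq (WP.load (by rw [hx']; exact hnat i (by omega))
      (by rw [hval]; split_ifs <;> assumption) ?_)
    refine WP.seq (WP.arith (by simpa [hx16, hx'] using hnat i (by omega))
      (by simpa [h3'] using hb1) (WP.arith (by simpa [x3, h3'] using hb1) ?_ ?_))
    · simp only [State.setVar_var, x16, if_true, if_false, hval]; split_ifs <;> assumption
    · simp only [State.setVar_var, State.setVar_arr, x3, x15, hx15, hx16, x16, hval, h3', hx',
        harr, Op.eval, if_true, if_false, Nat.reduceEqDiff, true_and]
      refine ⟨?_, by push_cast; ring⟩
      by_cases h : i = j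
      · simp [h]
      · simp [h]
  · rintro s' ⟨-, -, h15, -⟩; simp [h15]
  · rintro s' ⟨-, -, -, h⟩; exact h

theorem scanProg_vars (a x : ℕ) : (scanProg a x).vars = {x, 15, 16} := by
  ext z; simp [scanProg, Cmd.vars]; tauto

theorem scanProg_arrs (a x : ℕ) : (scanProg a x).arrs = ∅ := by simp [scanProg, Cmd.arrs]

theorem sizeProg_wp (hY : ∀ z : ℤ, |z| ≤ Y → bitLen z ≤ Z) {n : ℕ} (hn : Nat.clog 2 n ≤ Z)
    (hnY : (n + 1 : ℤ) ≤ Y) (hM : 2 * 2 ^ Nat.clog 2 n ≤ Y) (s : State) (h0 : s.var 0 = n + 1)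
    (h3 : s.var 3 = 1) : WP ω Z sizeProg (fun s' => s'.var 8 = 2 ^ Nat.clog 2 n) s := by
  have hM1 : (1 : ℤ) ≤ 2 ^ Nat.clog 2 n := one_le_pow₀ (by norm_num)
  have hb1 : bitLen 1 ≤ Z := hY _ (by rw [abs_one]; omega)
  have hbn : bitLen (n : ℤ) ≤ Z := hY _ (by rw [abs_of_nonneg] <;> omega)
  refine WP.seq (WP.const hb1 (WP.seq (WP.arith ?_ ?_ (WP.seq (WP.arith ?_ ?_ ?_)))))
  · simp only [State.setVar_var, OfNat.zero_ne_ofNat, if_false, h0]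
    exact hY _ (by rw [abs_of_nonneg] <;> omega)
  · simpa [h3] using hb1
  · simpa [h3, h0, Op.eval] using hbn
  · simpa using hb1
  refine WP.mono (WP.loop (N := Nat.clog 2 n) (fun i s' => s'.var 8 = 2 ^ i ∧
    s'.var 13 = n ∧ s'.var 15 = (n - 2 ^ i : ℤ)) hn ?_ ?_ ?_ ?_) ?_
  · simp [h0, h3, Op.eval]
  · rintro i s' hi ⟨-, -, h15⟩
    have h1 : (2 : ℤ) ^ i ≤ 2 ^ Nat.clog 2 n := pow_le_pow_right₀ (by norm_num) hi
    have h2 : (0 : ℤ) < 2 ^ i := by positivity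
    rw [h15]; exact hY _ (by rw [abs_le]; omega)
  · rintro i s' hi ⟨h8, h13, h15⟩
    have h1 : (2 : ℤ) ^ i ≤ 2 ^ Nat.clog 2 n := pow_le_pow_right₀ (by norm_num) hi.le
    have h1' : (2 : ℤ) ^ (i + 1) ≤ 2 ^ Nat.clog 2 n := pow_le_pow_right₀ (by norm_num) hi
    have h2 : (0 : ℤ) < 2 ^ i := by positivity
    have h3 : (2 : ℤ) ^ i < n := by
      exact_mod_cast (Nat.lt_clog_iff_pow_lt (by norm_num)).1 hi
    have h8b : bitLen (s'.var 8) ≤ Z := by rw [h8]; exact hY _ (by rw [abs_of_pos] <;> omega)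
    refine ⟨by omega, WP.seq (WP.arith h8b h8b (WP.arith ?_ ?_ ?_))⟩
    · simpa [h13] using hbn
    · simp only [State.setVar_var, if_true, Op.eval, h8]
      rw [pow_succ] at h1'
      exact hY _ (by rw [abs_of_pos] <;> omega)
    · simp [h8, h13, Op.eval, pow_succ]; ring
  · rintro s' ⟨-, -, h15⟩
    have : (n : ℤ) ≤ 2 ^ Nat.clog 2 n := by exact_mod_cast Nat.le_pow_clog (by norm_num) n
    omega
  · rintro s' ⟨h, -⟩; exact h

theorem sizeProg_vars : sizeProg.vars = {8, 13, 15} := by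
  ext z; simp [sizeProg, Cmd.vars]; tauto

theorem sizeProg_arrs : sizeProg.arrs = ∅ := by simp [sizeProg, Cmd.arrs]

theorem countProg_vars (C : ℕ) : ∀ x ∈ (countProg C).vars, 4 ≤ x := by
  intro x
  simp only [countProg, Cmd.vars, scanProg_vars, powProg_vars, Set.mem_union, Set.mem_insert_iff,
    Set.mem_singleton_iff]
  omega

theorem countProg_arrs (C : ℕ) : (countProg C).arrs = ∅ := by
  simp [countProg, Cmd.arrs, scanProg_arrs, powProg_arrs]

theorem countProg_wp (hY : ∀ z : ℤ, |z| ≤ Y → bitLen z ≤ Z) {C k i j D T : ℕ} (hk : k ≤ Z)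
    (hi : i + 1 ≤ Z) (hj : j + 1 ≤ Z) (hD : D = (C * k * k) ^ k)
    (hT : T = (2 ^ (i + 1) * D) ^ 2 * (j + 2)) (hC : 1 ≤ C)
    (hkY : (C * k * k : ℤ) ≤ Y) (hiY : (i + 1 : ℤ) ≤ Y) (hTY : (T : ℤ) ≤ Y)
    (hCY : (C : ℤ) ≤ Y) (hY2 : 2 ≤ Y) (s : State)
    (h2 : s.var 2 = 0) (h3 : s.var 3 = 1) (hk0 : s.arr 0 0 = k) (hi0 : ∀ l < i, s.arr 1 l = 0)
    (hi1 : s.arr 1 i = 1) (hj0 : ∀ l < j, s.arr 3 l = 0) (hj1 : s.arr 3 j = 1) :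
    WP ω Z (countProg C) (fun s' => s'.var 4 = k ∧ s'.var 7 = T) s := by
  have hD1 : 1 ≤ D := by
    rw [hD]
    rcases Nat.eq_zero_or_pos k with rfl | h
    · simp
    · exact Nat.one_le_pow _ _ (by positivity)
  have hE1 : 1 ≤ 2 ^ (i + 1) := Nat.one_le_two_pow
  have hED : 1 ≤ 2 ^ (i + 1) * D := Nat.mul_pos hE1 hD1
  have hED2 : (2 ^ (i + 1) * D) ^ 2 ≤ T := by rw [hT]; exact Nat.le_mul_of_pos_right _ (by omega)
  have hEDT : 2 ^ (i + 1) * D ≤ T := (Nat.le_self_pow (by norm_num) _).trans hED2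
  have hET : 2 ^ (i + 1) ≤ T := (Nat.le_mul_of_pos_right _ hD1).trans hEDT
  have hDT : D ≤ T := (Nat.le_mul_of_pos_left _ hE1).trans hEDT
  have hjT : j + 2 ≤ T := by rw [hT]; exact Nat.le_mul_of_pos_left _ (by positivity)
  have hnat : ∀ b : ℕ, (b : ℤ) ≤ Y → bitLen (b : ℤ) ≤ Z := fun a ha => hY _ (by simpa using ha)
  have hleT : ∀ b : ℕ, b ≤ T → (b : ℤ) ≤ Y := fun b hb => by omega
  have hb1 : bitLen 1 ≤ Z := by simpa using hnat 1 (by simp; omega)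
  have hb0 : bitLen 0 ≤ Z := by simpa using hnat 0 (by simp; omega)
  have hb2 : bitLen 2 ≤ Z := by simpa using hnat 2 (by simp; omega)
  have hkk : C * k ≤ C * k * k := by
    rcases Nat.eq_zero_or_pos k with rfl | h
    · simp
    · exact Nat.le_mul_of_pos_right _ h
  have hkk' : k ≤ C * k := Nat.le_mul_of_pos_left _ hC
  have hkkY : ((C * k : ℕ) : ℤ) ≤ Y := by zify at hkk; push_cast; linarith
  have hkY' : (k : ℤ) ≤ Y := by zify at hkk'; push_cast at hkkY; linarith
  refine WP.seq ((scanProg_wp hY (j := i) (by norm_num) (by norm_num) (by norm_num) hi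
    (by push_cast; exact hiY) s h3 hi0 hi1).frame.mono ?_)
  rintro s₁ ⟨a14, av, aa, -⟩
  simp only [scanProg_vars, scanProg_arrs, Set.mem_insert_iff, Set.mem_singleton_iff, not_or,
    Set.mem_empty_iff_false, not_false_eq_true, forall_const] at av aa
  refine WP.seq (WP.const hb2 (WP.seq ((powProg_wp hY (b := 2) (N := i + 1) (by norm_num)
    (by norm_num) (by norm_num) (by norm_num) (by norm_num) hi (by push_cast; exact hiY)
    (by simpa using hY2) (by omega) (fun l hl => hleT _ ((Nat.pow_le_pow_right (by norm_num)
    hl).trans hET)) _ ?_ ?_ ?_ ?_).frame.mono ?_)))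
  · simpa [h2] using av 2
  · simpa [h3] using av 3
  · simp
  · simp [a14]
  rintro s₂ ⟨b5, bv, ba, -⟩
  simp only [powProg_vars, powProg_arrs, Set.mem_insert_iff, Set.mem_singleton_iff, not_or,
    Set.mem_empty_iff_false, not_false_eq_true, forall_const, State.setVar_arr] at bv ba
  refine WP.seq ((scanProg_wp hY (j := j) (by norm_num) (by norm_num) (by norm_num) hj
    (hleT _ (by omega)) s₂ ?_ ?_ ?_).frame.mono ?_)
  · simp [bv 3, av 3, h3]
  · intro l hl; rw [ba, aa, hj0 l hl]
  · rw [ba, aa, hj1]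
  rintro s₃ ⟨c6, cv, ca, -⟩
  simp only [scanProg_vars, scanProg_arrs, Set.mem_insert_iff, Set.mem_singleton_iff, not_or,
    Set.mem_empty_iff_false, not_false_eq_true, forall_const] at cv ca
  have c2 : s₃.var 2 = 0 := by simp [cv 2, bv 2, av 2, h2]
  have c3 : s₃.var 3 = 1 := by simp [cv 3, bv 3, av 3, h3]
  have c5 : s₃.var 5 = (2 ^ (i + 1) : ℕ) := by rw [cv 5 (by simp), b5]
  have c00 : s₃.arr 0 0 = k := by rw [ca, ba, aa, hk0]
  have hb6 : bitLen (s₃.var 6) ≤ Z := by rw [c6]; exact hnat _ (hleT _ (by omega))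
  refine WP.seq (WP.arith hb6 (by rwa [c3]) (WP.seq (WP.const hb0 (WP.seq (WP.load ?_ ?_
    (WP.seq (WP.const (hnat _ hCY) (WP.seq (WP.arith ?_ ?_ (WP.seq (WP.arith ?_ ?_ ?_)))))))))))
  · simpa using hb0
  · simpa [State.index, c00] using hnat k hkY'
  · simpa using hnat _ hCY
  · simpa [State.index, c00] using hnat k hkY'
  · simpa [State.index, c00, Op.eval] using hnat _ hkkY
  · simpa [State.index, c00] using hnat k hkY'
  refine WP.seq ((powProg_wp hY (b := C * k * k) (N := k) (by norm_num)
    (by norm_num) (by norm_num) (by norm_num) (by norm_num) hk hkY' (by push_cast; exact hkY)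
    (by omega) (fun l hl => ?_) _ ?_ ?_ ?_ ?_).frame.mono ?_)
  · -- For `k = 0` the base is `0`, but only its zeroth power is formed.
    rcases Nat.eq_zero_or_pos k with rfl | h
    · obtain rfl : l = 0 := by omega
      simp; omega
    · exact hleT _ ((Nat.pow_le_pow_right (by positivity) hl).trans (hD ▸ hDT))
  · simpa using c2
  · simpa using c3
  · simp [State.index, c00, Op.eval]
  · simp [State.index, c00]
  rintro s₄ ⟨d18, dv, da, -⟩
  simp only [powProg_vars, Set.mem_insert_iff, Set.mem_singleton_iff, not_or] at dv
  rw [← hD] at d18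
  have d5 : s₄.var 5 = (2 ^ (i + 1) : ℕ) := by simpa [c5] using dv 5
  have d6 : s₄.var 6 = (j + 2 : ℕ) := by
    simpa [c6, c3, Op.eval, add_assoc] using dv 6
  have d4 : s₄.var 4 = k := by simpa [State.index, c00] using dv 4
  refine WP.seq (WP.arith ?_ ?_ (WP.seq (WP.arith ?_ ?_ (WP.arith ?_ ?_ ?_))))
  · rw [d5]; exact hnat _ (hleT _ hET)
  · rw [d18]; exact hnat _ (hleT _ hDT)
  · simpa [d5, d18, Op.eval] using hnat _ (hleT _ hEDT)
  · simpa [d5, d18, Op.eval] using hnat _ (hleT _ hEDT)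
  · simpa [d5, d18, Op.eval, sq] using hnat _ (hleT _ hED2)
  · simpa [d6] using hnat _ (hleT _ hjT)
  · simp [d4, d5, d6, d18, Op.eval, hT, sq]

theorem sampleLoop_vars (cs : List ℤ) : ∀ x ∈ (sampleLoop cs).vars, 10 ≤ x := by
  intro x
  have := sampleProg_vars cs x
  simp only [sampleLoop, Cmd.vars, Set.mem_union, Set.mem_singleton_iff]
  rintro (h | h | h | h)
  any_goals omega
  have := this h
  omega

open Classical in
/-- Correctness of the algorithm. The hypotheses ending in `Z` bound the numbers of rounds of the
loops, those with an upper bound `Y` the absolute values of the operands; `i` and `j` are the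
positions of the first `1` in the numerators of `ε` and `δ`. -/
theorem approxProg_wp (hY : ∀ z : ℤ, |z| ≤ Y → bitLen z ≤ Z) {w cs : List ℤ}
    {C k n m i j D T : ℕ} {V : ℤ} (hn : w.length = n + 1) (hm : m = Nat.clog 2 n)
    (hD : D = (C * k * k) ^ k) (hT : T = (2 ^ (i + 1) * D) ^ 2 * (j + 2)) (hC : 1 ≤ C)
    (hmZ : m ≤ Z) (hkZ : k ≤ Z) (hiZ : i + 1 ≤ Z) (hjZ : j + 1 ≤ Z) (hTZ : T ≤ Z)
    (hkY : (C * k * k : ℤ) ≤ Y) (hiY : (i + 1 : ℤ) ≤ Y) (hTY : (T : ℤ) ≤ Y)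
    (hCY : (C : ℤ) ≤ Y) (hM : 2 * 2 ^ m ≤ Y) (hMk : (2 ^ m) ^ k ≤ Y) (hnY : (n + 1 : ℤ) ≤ Y)
    (hw : ∀ i, |w.getD i 0| ≤ V) (hV : V ≤ Y) (hcs : (cs.map (|·|)).sum * V ≤ Y)
    (hcb : ∀ a ∈ cs, bitLen a ≤ Z) (s : State) (h0 : s.var 0 = w.length)
    (ha0 : ∀ i, s.arr 0 i = w.getD i 0) (hk0 : w.getD 0 0 = k) (hu : s.used = 0)
    (hi0 : ∀ l < i, s.arr 1 l = 0) (hi1 : s.arr 1 i = 1) (hj0 : ∀ l < j, s.arr 3 l = 0)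
    (hj1 : s.arr 3 j = 1) :
    WP ω Z (approxProg cs C) (fun s' => s'.var 1 = T ∧ s'.var 0 =
      (∑ i ∈ Finset.range T, if Success w cs k m ω (i * (k * m)) then 1 else 0) * (2 ^ m) ^ k)
      s := by
  have hM1 : (1 : ℤ) ≤ 2 ^ m := one_le_pow₀ (by norm_num)
  have hb1 : bitLen 1 ≤ Z := hY _ (by rw [abs_one]; omega)
  have hb0 : bitLen 0 ≤ Z := hY _ (by rw [abs_zero]; omega)
  have hbT : bitLen (T : ℤ) ≤ Z := hY _ (by rw [abs_of_nonneg] <;> omega)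
  have hkk : (k : ℤ) ≤ C * k * k := by
    have : k ≤ C * k * k := by
      rcases Nat.eq_zero_or_pos k with rfl | h
      · simp
      · exact Nat.le_mul_of_pos_left _ (Nat.mul_pos hC h)
    exact_mod_cast this
  refine WP.seq (WP.const hb0 (WP.seq (WP.const hb1 (WP.seq ((countProg_wp hY hkZ hiZ hjZ hD hT
    hC hkY hiY hTY hCY (by omega) _ ?_ ?_ ?_ ?_ ?_ ?_ ?_).frame.mono ?_)))))
  · simp
  · simp
  · simp [ha0]; simpa using hk0
  · simpa using hi0
  · simpa using hi1
  · simpa using hj0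
  · simpa using hj1
  rintro s₁ ⟨⟨a4, a7⟩, av, aa, au⟩
  have av' : ∀ x, x < 4 → s₁.var x = _ := fun x hx => av x fun h => by
    have := countProg_vars C x h; omega
  have au' : s₁.used = 0 := by
    rw [au (by simp [countProg, scanProg, powProg, Cmd.Flips])]; simpa using hu
  have aa' : ∀ i, s₁.arr 0 i = w.getD i 0 := fun i => by
    rw [aa 0 (by simp [countProg_arrs])]; simpa using ha0 i
  have a0 : s₁.var 0 = w.length := by rw [av' 0 (by norm_num)]; simpa using h0
  have a2 : s₁.var 2 = 0 := by rw [av' 2 (by norm_num)]; simp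
  have a3 : s₁.var 3 = 1 := by rw [av' 3 (by norm_num)]; simp
  refine WP.seq ((sizeProg_wp hY (n := n) (hm ▸ hmZ) hnY (hm ▸ hM) s₁ (by rw [a0, hn]; simp)
    a3).frame.mono ?_)
  rintro s₂ ⟨b8, bv, ba, bu⟩
  simp only [sizeProg_vars, sizeProg_arrs, Set.mem_insert_iff, Set.mem_singleton_iff, not_or,
    Set.mem_empty_iff_false, not_false_eq_true, forall_const] at bv ba
  rw [← hm] at b8
  have bu' : s₂.used = 0 := by rw [bu (by simp [sizeProg, Cmd.Flips]), au']
  refine WP.seq ((powProg_wp hY (b := 2 ^ m) (N := k) (by norm_num) (by norm_num) (by norm_num)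
    (by norm_num) (by norm_num) hkZ (by omega) (by push_cast; omega) (by omega)
    (fun l hl => ?_) s₂ ?_ ?_ ?_ ?_).frame.mono ?_)
  · refine le_trans ?_ hMk
    exact_mod_cast Nat.pow_le_pow_right (by positivity) hl
  · rw [bv 2 (by simp), a2]
  · rw [bv 3 (by simp), a3]
  · rw [b8]; simp
  · rw [bv 4 (by simp), a4]
  rintro s₃ ⟨c9, cv, ca, cu⟩
  simp only [powProg_vars, powProg_arrs, Set.mem_insert_iff, Set.mem_singleton_iff, not_or,
    Set.mem_empty_iff_false, not_false_eq_true, forall_const] at cv ca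
  have cu' : s₃.used = 0 := by rw [cu (by simp [powProg, Cmd.Flips]), bu']
  have c7 : s₃.var 7 = T := by rw [cv 7 (by simp), bv 7 (by simp), a7]
  have c2 : s₃.var 2 = 0 := by rw [cv 2 (by simp), bv 2 (by simp), a2]
  refine WP.seq (WP.const hb0 (WP.seq ((sampleLoop_wp hY hmZ hkZ hTZ (by omega) hTY hM
    (by rw [hn]; push_cast; exact hnY) hw hV hcs hcb _ ?_ ?_ ?_ ?_ ?_ ?_ ?_ ?_ ?_).frame.mono ?_)))
  · simp [cv 0, bv 0, a0]
  · simp [ca, ba, aa']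
  · simp [c2]
  · simp [cv 3, bv 3, a3]
  · simp [cv 4, bv 4, a4]
  · simp [c7]
  · simp [cv 8, b8]
  · simp
  · simp [cu']
  rintro s₄ ⟨d10, dv, -, -⟩
  have dv' : ∀ x, x < 10 → s₄.var x = s₃.var x := fun x hx => by
    rw [dv x fun h => by have := sampleLoop_vars cs x h; omega, State.setVar_var,
      if_neg (by omega)]
  have d9 : s₄.var 9 = (2 ^ m) ^ k := by rw [dv' 9 (by norm_num), c9]; simp
  have d7 : s₄.var 7 = T := by rw [dv' 7 (by norm_num), c7]
  have d2 : s₄.var 2 = 0 := by rw [dv' 2 (by norm_num), c2]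
  refine WP.seq (WP.arith ?_ ?_ (WP.arith (by simpa [d7] using hbT) (by simpa [d2] using hb0) ?_))
  · rw [d10]
    refine hY _ ?_
    rw [abs_of_nonneg (Finset.sum_nonneg fun i _ => by split_ifs <;> simp)]
    calc _ ≤ ∑ i ∈ Finset.range T, (1 : ℤ) :=
          Finset.sum_le_sum fun i _ => by split_ifs <;> simp
      _ ≤ Y := by simp; omega
  · rw [d9]; exact hY _ (by rw [abs_of_nonneg (by positivity)]; exact hMk)
  · simp only [State.setVar_var, Op.eval, Nat.reduceEqDiff, OfNat.ofNat_ne_zero, zero_ne_one,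
      if_true, if_false, d7, d2, d9, d10]
    exact ⟨by simp, trivial⟩

end

/-! ### Equations that are not translation-invariant -/

namespace LinearEq

variable {L : LinearEq}

theorem sum_coeff_ne_zero (hhom : L.Homogeneous) (hinv : ¬ L.TranslationInvariant) :
    ∑ i, L.coeff i ≠ 0 := fun h => hinv ⟨h, hhom⟩

theorem IsTrivial.sum_coeff_eq_zero {x : Fin L.numVars → ℤ} (h : L.IsTrivial x) :
    ∑ i, L.coeff i = 0 := by
  obtain ⟨P, -, hP⟩ := h
  rw [← P.biUnion_parts, Finset.sum_biUnion P.disjoint]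
  exact Finset.sum_eq_zero hP

/-- Without translation invariance no solution is trivial, so a solution-free set has no solutions
at all. -/
theorem isFree_iff (hhom : L.Homogeneous) (hinv : ¬ L.TranslationInvariant) {S : Set ℤ} :
    L.IsFree S ↔ ∀ x : Fin L.numVars → ℤ, (∀ i, x i ∈ S) → ∑ i, L.coeff i * x i ≠ 0 := by
  refine forall_congr' fun x => imp_congr_right fun _ => ?_
  rw [IsSolution, show L.rhs = 0 from hhom]
  exact imp_congr_right fun _ =>
    iff_false_intro fun h => sum_coeff_ne_zero hhom hinv h.sum_coeff_eq_zero

theorem IsFree.mono {S T : Set ℤ} (h : L.IsFree T) (hST : S ⊆ T) : L.IsFree S :=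
  fun x hx => h x fun i => hST (hx i)

theorem IsFree.zero_notMem (hhom : L.Homogeneous) (hinv : ¬ L.TranslationInvariant) {S : Set ℤ}
    (h : L.IsFree S) : (0 : ℤ) ∉ S := fun h0 =>
  (isFree_iff hhom hinv).1 h (fun _ => 0) (fun _ => h0) (by simp)

/-- The sum of the absolute values of the coefficients. -/
def weight (L : LinearEq) : ℕ := ∑ i, (L.coeff i).natAbs

theorem one_le_weight (hhom : L.Homogeneous) (hinv : ¬ L.TranslationInvariant) :
    1 ≤ L.weight := by
  by_contra h
  refine sum_coeff_ne_zero hhom hinv (Finset.sum_eq_zero fun i hi => ?_)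
  have : L.weight = 0 := by omega
  simpa using Finset.sum_eq_zero_iff.1 this i hi

/-- A set of nonzero integers contains a solution-free subset of positive density. Modulo a large
prime `p`, the residues in a suitable interval `[q, q + d]` satisfy no instance of the equation
even modulo `p`; on average over `t`, the elements `a` with `t * a` in that interval make up a
proportion `(d + 1) / p` of the set. -/
theorem exists_isFree_subset (hhom : L.Homogeneous) (hinv : ¬ L.TranslationInvariant)
    (A : Finset ℤ) (hA : (0 : ℤ) ∉ A) : ∃ B ⊆ A, L.IsFree (B : Set ℤ) ∧
      A.card ≤ 2 * L.weight * (L.weight + 1) * B.card := by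
  have hW := one_le_weight hhom hinv
  set W := L.weight with hWdef
  set d : ℕ := ∑ a ∈ A, a.natAbs
  have hd : ∀ a ∈ A, a.natAbs ≤ d := fun a ha =>
    Finset.single_le_sum (f := fun a : ℤ => a.natAbs) (fun _ _ => Nat.zero_le _) ha
  -- By Bertrand's postulate `p` can be taken of order `d`, which makes `(d + 1) / p` a constant.
  obtain ⟨p, hp, hlt, hle⟩ := Nat.exists_prime_lt_and_le_two_mul (W * (W * d + d + 1))
    (by positivity)
  have : Fact p.Prime := ⟨hp⟩
  have hbig : W * d + d + 1 ≤ W * (W * d + d + 1) := Nat.le_mul_of_pos_left _ hW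
  -- The interval is so far from `0` that `(∑ aᵢ) * q` outweighs the `W * d` by which the remainders
  -- in `[0, d]` can change it, and `W * (q + d) < p` excludes wrapping around.
  set q := W * d + 1
  let J : Finset (ZMod p) := {z | q ≤ z.val ∧ z.val ≤ q + d}
  have hJ : J.card = d + 1 := by
    have : J.image ZMod.val = Finset.Icc q (q + d) := by
      ext r
      simp only [J, Finset.mem_image, Finset.mem_filter, Finset.mem_univ, true_and,
        Finset.mem_Icc]
      constructor
      · rintro ⟨z, hz, rfl⟩; exact hz
      · intro hr
        have : ((r : ℕ) : ZMod p).val = r := ZMod.val_cast_of_lt (by omega)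
        exact ⟨r, by rwa [this], this⟩
    rw [← Finset.card_image_of_injective J (ZMod.val_injective p), this, Nat.card_Icc]
    omega
  let F : ZMod p → Finset ℤ := fun t => A.filter fun a => t * (a : ZMod p) ∈ J
  have hfree : ∀ t, L.IsFree (F t : Set ℤ) := by
    intro t
    rw [isFree_iff hhom hinv]
    intro x hx hsum
    let r : Fin L.numVars → ℤ := fun i => ((t * (x i : ZMod p)).val : ℤ)
    have hr : ∀ i, (q : ℤ) ≤ r i ∧ r i ≤ q + d := by
      intro i
      have := hx i
      simp only [F, J, Finset.coe_filter, Set.mem_ofPred_eq, Finset.mem_filter, Finset.mem_univ,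
        true_and] at this
      exact ⟨Int.ofNat_le.2 this.2.1, Int.ofNat_le.2 this.2.2⟩
    have hdvd : (p : ℤ) ∣ ∑ i, L.coeff i * r i := by
      rw [← ZMod.intCast_zmod_eq_zero_iff_dvd]
      have h0 : (((∑ i, L.coeff i * x i : ℤ)) : ZMod p) = 0 := by rw [hsum]; simp
      push_cast at h0 ⊢
      calc _ = t * ∑ i, (L.coeff i : ZMod p) * (x i : ZMod p) := by
            rw [Finset.mul_sum]
            refine Finset.sum_congr rfl fun i _ => ?_
            simp only [r, Int.cast_natCast, ZMod.natCast_zmod_val]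
            ring
        _ = 0 := by rw [h0, mul_zero]
    have hWcast : ∑ i, |L.coeff i| = (W : ℤ) := by
      rw [hWdef, weight]; push_cast; rfl
    have hsmall : |∑ i, L.coeff i * r i| < p := by
      calc |∑ i, L.coeff i * r i| ≤ ∑ i, |L.coeff i * r i| := Finset.abs_sum_le_sum_abs _ _
        _ ≤ ∑ i, |L.coeff i| * (q + d) := by
            refine Finset.sum_le_sum fun i _ => ?_
            have := hr i
            rw [abs_mul, abs_of_nonneg (by omega : 0 ≤ r i)]
            exact mul_le_mul_of_nonneg_left this.2 (abs_nonneg _)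
        _ = W * (q + d) := by rw [← Finset.sum_mul, hWcast]
        _ < p := by
            have : W * (q + d) < p := by
              have : W * d + d + 1 = q + d := by simp only [q]; ring
              rwa [← this]
            exact_mod_cast this
    have hzero := Int.eq_zero_of_abs_lt_dvd hdvd hsmall
    have hsplit : ∑ i, L.coeff i * r i =
        (∑ i, L.coeff i) * q + ∑ i, L.coeff i * (r i - q) := by
      rw [Finset.sum_mul, ← Finset.sum_add_distrib]
      exact Finset.sum_congr rfl fun i _ => by ring
    have herr : |∑ i, L.coeff i * (r i - q)| ≤ W * d := by
      calc _ ≤ ∑ i, |L.coeff i * (r i - q)| := Finset.abs_sum_le_sum_abs _ _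
        _ ≤ ∑ i, |L.coeff i| * d := by
            refine Finset.sum_le_sum fun i _ => ?_
            have := hr i
            rw [abs_mul, abs_of_nonneg (by omega : 0 ≤ r i - q)]
            exact mul_le_mul_of_nonneg_left (by omega) (abs_nonneg _)
        _ = W * d := by rw [← Finset.sum_mul, hWcast]
    have hs : 1 ≤ |∑ i, L.coeff i| := Int.one_le_abs (sum_coeff_ne_zero hhom hinv)
    have hmain : (q : ℤ) ≤ |(∑ i, L.coeff i) * q| := by
      rw [abs_mul, abs_of_nonneg (by positivity : (0 : ℤ) ≤ q)]
      exact le_mul_of_one_le_left (by positivity) hs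
    have heq : (∑ i, L.coeff i) * q = -∑ i, L.coeff i * (r i - q) := by linarith
    rw [heq, abs_neg] at hmain
    have : (q : ℤ) = W * d + 1 := by simp [q]
    omega
  have hcount : ∑ t, (F t).card = A.card * (d + 1) := by
    simp only [F, Finset.card_filter]
    rw [Finset.sum_comm, ← smul_eq_mul, ← Finset.sum_const]
    refine Finset.sum_congr rfl fun a ha => ?_
    have ha0 : (a : ZMod p) ≠ 0 := by
      rw [Ne, ZMod.intCast_zmod_eq_zero_iff_dvd]
      intro h
      have := Int.natAbs_dvd_natAbs.2 h
      have h1 : a.natAbs ≠ 0 := by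
        rw [Int.natAbs_ne_zero]; rintro rfl; exact hA ha
      have := Nat.le_of_dvd (by omega) this
      have := hd a ha
      simp only [Int.natAbs_natCast] at *
      omega
    rw [← Finset.card_filter, ← hJ]
    refine Finset.card_bij (fun t _ => t * a) (fun t ht => by simpa using ht)
      (fun t _ t' _ h => mul_right_cancel₀ ha0 h) fun z hz => ⟨z * (a : ZMod p)⁻¹, ?_, ?_⟩
    · simpa [ha0] using hz
    · simp [ha0]
  obtain ⟨t, -, ht⟩ := Finset.exists_le_of_sum_le (s := (Finset.univ : Finset (ZMod p)))
    (f := fun _ => A.card * (d + 1)) (g := fun t => p * (F t).card) Finset.univ_nonempty (by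
      rw [Finset.sum_const, Finset.card_univ, ZMod.card, smul_eq_mul, ← Finset.mul_sum, hcount])
  refine ⟨F t, Finset.filter_subset _ _, hfree t, ?_⟩
  refine Nat.le_of_mul_le_mul_right (ht.trans ?_) (Nat.succ_pos d)
  calc p * (F t).card ≤ (2 * (W * (W * d + d + 1))) * (F t).card := Nat.mul_le_mul_right _ hle
    _ ≤ (2 * (W * ((W + 1) * (d + 1)))) * (F t).card := by
        gcongr; nlinarith
    _ = _ := by ring

/-- If there is a solution-free `k`-subset of `A` at all, then they make up a proportion of the
`k`-tuples that is bounded below in terms of `k`. -/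
theorem pow_le_mul_countFree (hhom : L.Homogeneous) (hinv : ¬ L.TranslationInvariant)
    (I : Instance) (h : L.countFree I ≠ 0) : (2 ^ Nat.clog 2 I.A.card) ^ I.k ≤
      (8 * L.weight * (L.weight + 1) * I.k * I.k) ^ I.k * L.countFree I := by
  obtain ⟨A, k⟩ := I
  rcases Nat.eq_zero_or_pos k with rfl | hk
  · simp only [pow_zero, one_mul]; omega
  simp only
  have hfin : {B : Finset ℤ | B ⊆ A ∧ B.card = k ∧ L.IsFree (B : Set ℤ)}.Finite :=
    (A.powerset.finite_toSet).subset fun B hB => by simpa using hB.1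
  obtain ⟨B₀, hB₀A, hB₀k : B₀.card = k, hB₀⟩ := Set.nonempty_of_ncard_ne_zero h
  have hA' : 1 ≤ (A.erase 0).card := by
    have h0 := hB₀.zero_notMem hhom hinv
    have : B₀ ⊆ A.erase 0 := fun b hb =>
      Finset.mem_erase.2 ⟨fun hb0 => h0 (by simpa [hb0] using hb), hB₀A hb⟩
    exact (by omega : 1 ≤ B₀.card).trans (Finset.card_le_card this)
  obtain ⟨F, hFA, hF, hFc⟩ := exists_isFree_subset hhom hinv (A.erase 0) (by simp)
  set C := 2 * L.weight * (L.weight + 1)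
  have hcard := Finset.pred_card_le_card_erase (s := A) (a := (0 : ℤ))
  have hclog : 2 ^ Nat.clog 2 A.card ≤ 2 * A.card := by
    rcases Nat.lt_or_ge 1 A.card with h1 | h1
    · have := Nat.pow_pred_clog_lt_self (b := 2) (by norm_num) h1
      have hpos : 0 < Nat.clog 2 A.card := Nat.clog_pos (by norm_num) h1
      rw [← Nat.succ_pred_eq_of_pos hpos, pow_succ]
      omega
    · have : A.card = 1 := by
        have := Finset.card_le_card (Finset.erase_subset (0 : ℤ) A); omega
      simp [this]
  set b := F.card
  have hMb : 2 ^ Nat.clog 2 A.card ≤ 4 * C * b := by rw [mul_assoc]; omega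
  have hC : 8 * L.weight * (L.weight + 1) * k * k = 4 * C * (k * k) := by simp only [C]; ring
  rw [hC]
  -- If `A` has few elements, a single `k`-subset is enough.
  rcases Nat.lt_or_ge b k with hbk | hbk
  · calc (2 ^ Nat.clog 2 A.card) ^ k ≤ (4 * C * (k * k)) ^ k := by
          refine Nat.pow_le_pow_left (hMb.trans (Nat.mul_le_mul_left _ ?_)) _
          exact hbk.le.trans (Nat.le_mul_of_pos_left _ hk)
      _ ≤ _ := Nat.le_mul_of_pos_right _ (Nat.pos_of_ne_zero h)
  · have hchoose : b.choose k ≤ L.countFree ⟨A, k⟩ := by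
      rw [← Finset.card_powersetCard, ← Set.ncard_coe_finset]
      refine Set.ncard_le_ncard (fun B hB => ?_) hfin
      rw [Finset.mem_coe, Finset.mem_powersetCard] at hB
      exact ⟨hB.1.trans (hFA.trans (Finset.erase_subset _ _)), hB.2,
        hF.mono (by exact_mod_cast hB.1)⟩
    have hb : b ≤ k * (b + 1 - k) := by
      obtain ⟨c, hc⟩ := Nat.exists_eq_add_of_le hbk
      rw [hc, show k + c + 1 - k = c + 1 by omega]
      nlinarith
    calc (2 ^ Nat.clog 2 A.card) ^ k ≤ (4 * C * (k * (b + 1 - k))) ^ k :=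
          Nat.pow_le_pow_left (hMb.trans (Nat.mul_le_mul_left _ hb)) _
      _ = (4 * C) ^ k * k ^ k * (b + 1 - k) ^ k := by
          rw [mul_pow (4 * C), mul_pow k, mul_assoc]
      _ ≤ (4 * C) ^ k * k ^ k * (k ^ k * b.choose k) := by
          refine Nat.mul_le_mul_left _ ((Nat.pow_sub_le_descFactorial b k).trans ?_)
          rw [Nat.descFactorial_eq_factorial_mul_choose]
          exact Nat.mul_le_mul_right _ (Nat.factorial_le_pow k)
      _ = (4 * C * (k * k)) ^ k * b.choose k := by rw [mul_pow (4 * C), mul_pow k k]; ring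
      _ ≤ _ := Nat.mul_le_mul_left _ hchoose

end LinearEq

/-- The recursive predicate checked by the nested loops says that there is a solution. -/
theorem hasSol_ofFn_iff {B : ℕ → ℤ} {k : ℕ} : ∀ {n : ℕ} (c : Fin n → ℤ) (σ : ℤ),
    HasSol B k (List.ofFn c) σ ↔ ∃ x : Fin n → ℤ,
      (∀ i, ∃ j, 1 ≤ j ∧ j ≤ k ∧ x i = B j) ∧ σ + ∑ i, c i * x i = 0 := by
  intro n
  induction n with
  | zero => intro c σ; simp [HasSol]
  | succ n ih =>
    intro c σ
    simp only [List.ofFn_succ, HasSol, ih, Fin.sum_univ_succ]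
    constructor
    · rintro ⟨j, h1, hk, x, hx, hsum⟩
      refine ⟨Fin.cons (B j) x, Fin.cases ⟨j, h1, hk, by simp⟩ (by simpa using hx), ?_⟩
      simpa [add_assoc] using hsum
    · rintro ⟨x, hx, hsum⟩
      obtain ⟨j, h1, hk, hj⟩ := hx 0
      refine ⟨j, h1, hk, fun i => x i.succ, fun i => hx i.succ, ?_⟩
      rw [← hj, ← hsum]; ring

/-! ### Counting the successful coin sequences -/

theorem readNat_congr_iff {ω ω' : ℕ → Bool} {u u' m : ℕ} :
    readNat ω u m = readNat ω' u' m ↔ ∀ i < m, ω (u + i) = ω' (u' + i) := by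
  induction m with
  | zero => simp [readNat]
  | succ m ih =>
    rw [Nat.forall_lt_succ_right, ← ih, readNat, readNat]
    cases ω (u + m) <;> cases ω' (u' + m) <;> simp <;> omega

theorem draw_congr {ω ω' : ℕ → Bool} {u u' k m : ℕ}
    (h : ∀ i < k * m, ω (u + i) = ω' (u' + i)) {j : ℕ} (hj : j < k) :
    draw ω m u j = draw ω' m u' j := by
  rw [draw, draw, readNat_congr_iff.2]
  intro i hi
  rw [add_assoc, add_assoc]
  refine h _ ?_
  calc j * m + i < (j + 1) * m := by rw [add_mul]; omega
    _ ≤ k * m := Nat.mul_le_mul_right _ hj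

theorem hasSol_congr {B B' : ℕ → ℤ} {k : ℕ} (h : ∀ i, 1 ≤ i → i ≤ k → B i = B' i) :
    ∀ (cs : List ℤ) (σ : ℤ), HasSol B k cs σ ↔ HasSol B' k cs σ
  | [], _ => Iff.rfl
  | a :: cs, σ => by
    refine exists_congr fun i => and_congr_right fun h1 => and_congr_right fun hk => ?_
    rw [h i h1 hk]
    exact hasSol_congr h cs _

/-- Success depends on the `k * m` coins from `u` on only. -/
theorem success_congr {w cs : List ℤ} {k m : ℕ} {ω ω' : ℕ → Bool} {u u' : ℕ}
    (h : ∀ i < k * m, ω (u + i) = ω' (u' + i)) :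
    Success w cs k m ω u ↔ Success w cs k m ω' u' := by
  have hd := fun j (hj : j < k) => draw_congr h hj
  refine and_congr (forall₂_congr fun j hj => ?_) (not_congr (hasSol_congr (fun i h1 hk => ?_) _ _))
  · rw [hd j hj]
    cases j with
    | zero => rfl
    | succ j => rw [lastDraw, lastDraw, hd j (by omega)]
  · simp only [hd (k - i) (by omega)]

/-- The infinite coin sequence that begins with `β` and goes on with tails. -/
def extend {q : ℕ} (β : Fin q → Bool) (i : ℕ) : Bool := if h : i < q then β ⟨i, h⟩ else false

/-- The `k` numbers encoded by `k * m` coins. -/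
def positions {k m : ℕ} (β : Fin (k * m) → Bool) (j : Fin k) : Fin (2 ^ m) :=
  ⟨readNat (extend β) (j * m) m, readNat_lt _ _ _⟩

theorem positions_bijective (k m : ℕ) : Function.Bijective (positions (k := k) (m := m)) := by
  rw [Fintype.bijective_iff_injective_and_card]
  refine ⟨fun β β' h => funext fun i => ?_, by simp [pow_mul']⟩
  have hm : 0 < m := Nat.pos_of_ne_zero fun h0 => by
    have := i.2; simp [h0] at this
  have hj : i.1 / m < k := Nat.div_lt_of_lt_mul (i.2.trans_eq (mul_comm k m))
  have h1 := congrArg Fin.val (congrFun h ⟨i.1 / m, hj⟩)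
  have h2 := readNat_congr_iff.1 h1 (i.1 % m) (Nat.mod_lt _ hm)
  have h3 : i.1 / m * m + i.1 % m = i := Nat.div_add_mod' _ _
  simpa [h3, extend] using h2

/-- A sample is a success if and only if its positions list, in increasing order, the elements of a
solution-free set. -/
theorem success_iff {L : LinearEq} (hhom : L.Homogeneous) (hinv : ¬ L.TranslationInvariant)
    {k m : ℕ} {l : List ℤ} (β : Fin (k * m) → Bool) :
    Success ((k : ℤ) :: l) (List.ofFn L.coeff) k m (extend β) 0 ↔
      StrictMono (fun j => (positions β j : ℕ)) ∧ (∀ j, (positions β j : ℕ) < l.length) ∧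
      L.IsFree ((Finset.univ.image fun j : Fin k => l.getD (positions β j) 0 : Finset ℤ) :
        Set ℤ) := by
  have hdraw : ∀ j : Fin k, draw (extend β) m 0 j = positions β j + 1 := fun j => by
    simp [draw, positions]
  rw [Success, ← and_assoc]
  refine and_congr ⟨fun h => ⟨?_, fun j => ?_⟩, fun h j hj => ⟨?_, ?_⟩⟩ ?_
  · have key : ∀ j < k, ∀ i < j, draw (extend β) m 0 i < draw (extend β) m 0 j := by
      intro j
      induction j with
      | zero => intro _ i hi; omega
      | succ j ih =>
        intro hj i hi
        have h1 : draw (extend β) m 0 j < draw (extend β) m 0 (j + 1) := (h (j + 1) hj).1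
        rcases Nat.lt_succ_iff_lt_or_eq.1 hi with h2 | rfl
        · exact (ih (by omega) i h2).trans h1
        · exact h1
    intro i j hij
    have := key j j.2 i hij
    rw [hdraw, hdraw] at this
    simpa using this
  · have := (h j j.2).2
    rw [hdraw, List.length_cons] at this
    omega
  · cases j with
    | zero => exact Nat.succ_pos _
    | succ j =>
      have h1 := h.1 (show (⟨j, by omega⟩ : Fin k) < ⟨j + 1, hj⟩ by simp)
      have h2 := hdraw ⟨j, by omega⟩
      have h3 := hdraw ⟨j + 1, hj⟩
      simp only [lastDraw] at *
      omega
  · have := h.2 ⟨j, hj⟩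
    have h3 := hdraw ⟨j, hj⟩
    simp only [List.length_cons] at *
    omega
  · rw [hasSol_ofFn_iff, LinearEq.isFree_iff hhom hinv]
    push Not
    refine forall_congr' fun x => ?_
    rw [zero_add]
    refine imp_congr (forall_congr' fun i => ?_) Iff.rfl
    simp only [Finset.coe_image, Finset.coe_univ, Set.image_univ, Set.mem_range]
    constructor
    · rintro ⟨j, h1, hk, hx⟩
      refine ⟨⟨k - j, by omega⟩, ?_⟩
      rw [hx, ← List.getD_cons_succ (x := (k : ℤ)), ← hdraw]
    · rintro ⟨j, hx⟩
      refine ⟨k - j, by omega, by omega, ?_⟩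
      rw [← hx, show k - (k - (j : ℕ)) = j by omega, hdraw, List.getD_cons_succ]

open Classical in
/-- Each solution-free subset of size `k` comes from exactly one sequence of `k * m` coins: the one
that lists its positions in increasing order. -/
theorem card_success {L : LinearEq} (hhom : L.Homogeneous) (hinv : ¬ L.TranslationInvariant)
    (I : Instance) {l : List ℤ} (hl : l.Nodup) (hlA : l.toFinset = I.A) {m : ℕ}
    (hm : l.length ≤ 2 ^ m) :
    (Finset.univ.filter fun β : Fin (I.k * m) → Bool =>
      Success ((I.k : ℤ) :: l) (List.ofFn L.coeff) I.k m (extend β) 0).card = L.countFree I := by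
  obtain ⟨A, k⟩ := I
  simp only at *
  rw [← Set.ncard_coe_finset, LinearEq.countFree]
  have hget : ∀ {i j : ℕ}, i < l.length → j < l.length → l.getD i 0 = l.getD j 0 → i = j := by
    intro i j hi hj h
    rw [List.getD_eq_getElem _ _ hi, List.getD_eq_getElem _ _ hj] at h
    exact (hl.getElem_inj_iff).1 h
  refine Set.ncard_congr (fun β _ => Finset.univ.image fun j : Fin k => l.getD (positions β j) 0)
    (fun β hβ => ?_) (fun β β' hβ hβ' h => ?_) (fun B hB => ?_)
  · simp only [Finset.coe_filter, Finset.mem_univ, true_and, Set.mem_ofPred_eq,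
      success_iff hhom hinv] at hβ
    obtain ⟨hmono, hlt, hfree⟩ := hβ
    refine ⟨fun z hz => ?_, ?_, hfree⟩
    · obtain ⟨j, -, rfl⟩ := Finset.mem_image.1 hz
      rw [← hlA, List.mem_toFinset, List.getD_eq_getElem _ _ (hlt j)]
      exact List.getElem_mem _
    · rw [Finset.card_image_of_injective _ fun i j hij => hmono.injective (hget (hlt i) (hlt j) hij)]
      simp
  · simp only [Finset.coe_filter, Finset.mem_univ, true_and, Set.mem_ofPred_eq,
      success_iff hhom hinv] at hβ hβ'
    refine (positions_bijective k m).1 (funext fun j => Fin.ext ?_)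
    refine congrFun ((hβ.1.range_inj hβ'.1).1 ?_) j
    have sub : ∀ γ γ' : Fin (k * m) → Bool, (∀ j, (positions γ j : ℕ) < l.length) →
        (∀ j, (positions γ' j : ℕ) < l.length) →
        (Finset.univ.image fun j : Fin k => l.getD (positions γ j) 0) =
          (Finset.univ.image fun j : Fin k => l.getD (positions γ' j) 0) →
        Set.range (fun j => (positions γ j : ℕ)) ⊆ Set.range fun j => (positions γ' j : ℕ) := by
      rintro γ γ' hγ hγ' h _ ⟨j, rfl⟩
      have : l.getD (positions γ j) 0 ∈
          Finset.univ.image fun j : Fin k => l.getD (positions γ' j) 0 :=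
        h ▸ Finset.mem_image_of_mem _ (Finset.mem_univ j)
      obtain ⟨i, -, hi⟩ := Finset.mem_image.1 this
      exact ⟨i, hget (hγ' i) (hγ j) hi⟩
    exact (sub _ _ hβ.2.1 hβ'.2.1 h).antisymm (sub _ _ hβ'.2.1 hβ.2.1 h.symm)
  · obtain ⟨hBA, hBk : B.card = k, hfree⟩ := hB
    let K : Finset ℕ := (Finset.range l.length).filter fun i => l.getD i 0 ∈ B
    have himg : K.image (fun i => l.getD i 0) = B := by
      ext z
      simp only [K, Finset.mem_image, Finset.mem_filter, Finset.mem_range]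
      constructor
      · rintro ⟨i, hi, rfl⟩; exact hi.2
      · intro hz
        have := hBA hz
        rw [← hlA, List.mem_toFinset] at this
        obtain ⟨i, hi, rfl⟩ := List.getElem_of_mem this
        have he := List.getD_eq_getElem l 0 hi
        exact ⟨i, ⟨hi, he ▸ hz⟩, he⟩
    have hKlt : ∀ i ∈ K, i < l.length := fun i hi =>
      Finset.mem_range.1 (Finset.mem_filter.1 hi).1
    have hK : K.card = k := by
      rw [← hBk, ← himg, Finset.card_image_of_injOn]
      exact fun i hi j hj h => hget (hKlt i hi) (hKlt j hj) h
    obtain ⟨β, hβ⟩ := (positions_bijective k m).2 fun j =>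
      ⟨K.orderEmbOfFin hK j, (hKlt _ (K.orderEmbOfFin_mem hK j)).trans_le hm⟩
    have hpos : ∀ j, (positions β j : ℕ) = K.orderEmbOfFin hK j := fun j => by rw [hβ]
    have hB' : (Finset.univ.image fun j : Fin k => l.getD (positions β j) 0) = B := by
      rw [← himg]
      simp only [hpos]
      exact (Finset.image_image (f := K.orderEmbOfFin hK) (g := fun i => l.getD i 0)).symm.trans
        (congrArg _ (K.image_orderEmbOfFin_univ hK))
    refine ⟨β, ?_, hB'⟩
    simp only [Finset.coe_filter, Finset.mem_univ, true_and, Set.mem_ofPred_eq,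
      success_iff hhom hinv, hB']
    refine ⟨fun i j hij => ?_, fun j => ?_, hfree⟩
    · simpa only [hpos] using (K.orderEmbOfFin hK).strictMono hij
    · rw [hpos]; exact hKlt _ (K.orderEmbOfFin_mem hK j)

/-! ### Concentration -/

section Concentration

open MeasureTheory ProbabilityTheory

/-- Hoeffding's inequality for the two-sided deviation of the number of successes among `T`
independent trials. -/
theorem measureReal_abs_sum_sub_ge_le {Ω : Type*} [MeasurableSpace Ω] {μ : Measure Ω}
    [IsProbabilityMeasure μ] {X : ℕ → Ω → ℝ} (hind : iIndepFun X μ) (hX : ∀ i, Measurable (X i))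
    (h01 : ∀ i ω, X i ω ∈ Set.Icc (0 : ℝ) 1) {p : ℝ} (hp : ∀ i, ∫ ω, X i ω ∂μ = p) {T : ℕ}
    (hT : 0 < T) {η : ℝ} (hη : 0 ≤ η) :
    μ.real {ω | T * η ≤ |∑ i ∈ Finset.range T, X i ω - T * p|} ≤
      2 * Real.exp (-(2 * T * η ^ 2)) := by
  have hsub : ∀ i, HasSubgaussianMGF (fun ω => X i ω - p) ((‖(1 : ℝ) - 0‖₊ / 2) ^ 2) μ := by
    intro i
    have := hasSubgaussianMGF_of_mem_Icc (μ := μ) (hX i).aemeasurable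
      (Filter.Eventually.of_forall (h01 i))
    rwa [hp i] at this
  have hc : (((‖(1 : ℝ) - 0‖₊ / 2) ^ 2 : NNReal) : ℝ) = 1 / 4 := by
    simp; norm_num
  have hexp : -(T * η) ^ 2 / (2 * T * (((‖(1 : ℝ) - 0‖₊ / 2) ^ 2 : NNReal) : ℝ)) =
      -(2 * T * η ^ 2) := by
    rw [hc]; field_simp; ring
  have h1 := HasSubgaussianMGF.measure_sum_range_ge_le_of_iIndepFun (n := T)
    (hind.comp (fun _ x => x - p) fun _ => measurable_id.sub_const p) (fun i _ => hsub i)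
    (by positivity : 0 ≤ T * η)
  have h2 := HasSubgaussianMGF.measure_sum_range_ge_le_of_iIndepFun (n := T)
    (hind.comp (fun _ x => -(x - p)) fun _ => (measurable_id.sub_const p).neg)
    (fun i _ => (hsub i).neg) (by positivity : 0 ≤ T * η)
  rw [hexp] at h1 h2
  have hsum : ∀ ω, ∑ i ∈ Finset.range T, (X i ω - p) = ∑ i ∈ Finset.range T, X i ω - T * p := by
    intro ω; simp [Finset.sum_sub_distrib]
  refine (measureReal_mono (fun ω hω => ?_)).trans
    ((measureReal_union_le _ _).trans ((add_le_add h1 h2).trans_eq (by ring)))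
  simp only [Set.mem_union, Set.mem_ofPred_eq, Function.comp_apply, Finset.sum_neg_distrib, hsum]
    at hω ⊢
  rcases le_abs.1 hω with h | h
  · exact Or.inl h
  · exact Or.inr h

instance : IsProbabilityMeasure coinMeasure := by unfold coinMeasure; infer_instance

/-- The `i`-th block of `q` coins. -/
def block (q i : ℕ) (ω : ℕ → Bool) (j : Fin q) : Bool := ω (i * q + j)

/-- The blocks of `q` coins are independent, and each consists of independent fair coins. -/
theorem map_blocks (q : ℕ) : coinMeasure.map (fun ω i => block q i ω) =
    Measure.infinitePi fun _ : ℕ => Measure.infinitePi fun _ : Fin q =>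
      (PMF.uniformOfFintype Bool).toMeasure := by
  have hinj : Function.Injective fun p : ℕ × Fin q => p.1 * q + (p.2 : ℕ) := by
    rintro ⟨i, j⟩ ⟨i', j'⟩ h
    have hq : 0 < q := j.pos
    simp only at h
    have h1 := congrArg (· / q) h
    have h2 := congrArg (· % q) h
    simp only [mul_comm _ q, Nat.mul_add_div hq, Nat.mul_add_mod, Nat.div_eq_of_lt j.2,
      Nat.div_eq_of_lt j'.2, Nat.mod_eq_of_lt j.2, Nat.mod_eq_of_lt j'.2] at h1 h2
    exact Prod.ext (by simpa using h1) (Fin.ext h2)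
  have h := Measure.map_infinitePi_infinitePi_of_inj
    (P := fun _ : ℕ => (PMF.uniformOfFintype Bool).toMeasure) hinj
  rw [← Measure.infinitePi_map_curry, ← h, Measure.map_map (by fun_prop) (by fun_prop)]
  rfl

theorem measurable_block (q i : ℕ) : Measurable (block q i) := by
  unfold block; fun_prop

theorem iIndepFun_block (q : ℕ) : iIndepFun (block q) coinMeasure := by
  rw [iIndepFun_iff_map_fun_eq_infinitePi_map (measurable_block q), map_blocks]
  congr 1
  funext i
  rw [← Measure.infinitePi_map_eval (fun _ : ℕ => Measure.infinitePi fun _ : Fin q =>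
    (PMF.uniformOfFintype Bool).toMeasure) i, ← map_blocks, Measure.map_map (by fun_prop)
    (measurable_pi_lambda _ fun i => measurable_block q i)]
  rfl

theorem measureReal_block_mem (q i : ℕ) (S : Finset (Fin q → Bool)) :
    coinMeasure.real {ω | block q i ω ∈ S} = S.card / 2 ^ q := by
  have hlaw : coinMeasure.map (block q i) =
      Measure.infinitePi fun _ : Fin q => (PMF.uniformOfFintype Bool).toMeasure := by
    rw [← Measure.infinitePi_map_eval (fun _ : ℕ => Measure.infinitePi fun _ : Fin q =>
      (PMF.uniformOfFintype Bool).toMeasure) i, ← map_blocks, Measure.map_map (by fun_prop)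
      (measurable_pi_lambda _ fun i => measurable_block q i)]
    rfl
  have h1 : coinMeasure.real {ω | block q i ω ∈ S} =
      (coinMeasure.map (block q i)).real (S : Set (Fin q → Bool)) := by
    rw [map_measureReal_apply (measurable_block q i) S.measurableSet]; rfl
  have : IsProbabilityMeasure (coinMeasure.map (block q i)) := by rw [hlaw]; infer_instance
  rw [h1, ← sum_measureReal_singleton]
  have h2 : ∀ β : Fin q → Bool, (coinMeasure.map (block q i)).real {β} = (1 / 2) ^ q := by
    intro β
    rw [hlaw, measureReal_def, Measure.infinitePi_singleton_of_fintype]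
    simp
  rw [Finset.sum_congr rfl fun β _ => h2 β]
  simp [div_eq_mul_inv]

open Classical in
/-- The number of successful samples concentrates around `T` times the success probability. -/
theorem measureReal_success_deviation {L : LinearEq} (hhom : L.Homogeneous)
    (hinv : ¬ L.TranslationInvariant) (I : Instance) {l : List ℤ} (hl : l.Nodup)
    (hlA : l.toFinset = I.A) {m : ℕ} (hm : l.length ≤ 2 ^ m) {T : ℕ} (hT : 0 < T) {η : ℝ}
    (hη : 0 ≤ η) :
    coinMeasure.real {ω | T * η ≤ |∑ i ∈ Finset.range T,
        (if Success ((I.k : ℤ) :: l) (List.ofFn L.coeff) I.k m ω (i * (I.k * m)) then (1 : ℝ)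
          else 0) - T * (L.countFree I / 2 ^ (I.k * m))|} ≤
      2 * Real.exp (-(2 * T * η ^ 2)) := by
  set S := Finset.univ.filter fun β : Fin (I.k * m) → Bool =>
      Success ((I.k : ℤ) :: l) (List.ofFn L.coeff) I.k m (extend β) 0 with hS
  have hmem : ∀ i ω, Success ((I.k : ℤ) :: l) (List.ofFn L.coeff) I.k m ω (i * (I.k * m)) ↔
      block (I.k * m) i ω ∈ S := by
    intro i ω
    rw [hS, Finset.mem_filter]
    simp only [Finset.mem_univ, true_and]
    refine success_congr fun j hj => ?_
    simp [extend, block, hj]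
  simp only [hmem]
  refine measureReal_abs_sum_sub_ge_le
    (X := fun i ω => if block (I.k * m) i ω ∈ S then (1 : ℝ) else 0)
    ((iIndepFun_block (I.k * m)).comp (fun _ β => if β ∈ S then (1 : ℝ) else 0)
      fun _ => measurable_of_finite _) (fun i => ?_) (fun i ω => ?_) (fun i => ?_) hT hη
  · exact (measurable_of_finite fun β => if β ∈ S then (1 : ℝ) else 0).comp (measurable_block _ i)
  · split_ifs <;> simp
  · have hms : MeasurableSet {ω | block (I.k * m) i ω ∈ S} := measurable_block _ i S.measurableSet
    have : (fun ω => if block (I.k * m) i ω ∈ S then (1 : ℝ) else 0) =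
        Set.indicator {ω | block (I.k * m) i ω ∈ S} 1 := by
      ext ω; simp [Set.indicator_apply]
    rw [this, integral_indicator_one hms, measureReal_block_mem, card_success hhom hinv I hl hlA hm]

end Concentration

/-! ### Reading the accuracy and the confidence -/

/-- The position `j` of the first `1` in the numerator determines `r` up to a factor of `4`, unless
`j = 0`, when `r` may be arbitrarily large. If `0 < j`, the numerator is padded, so the denominator
has its leading digit at position `0`. -/
theorem exists_first_digit {r : ℚ} (hr : 0 < r) : ∃ j : ℕ,
    (∀ l < j, digit (digitLen r) r.num.natAbs l = 0) ∧ digit (digitLen r) r.num.natAbs j = 1 ∧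
    1 < (r : ℝ) * 2 ^ (j + 1) ∧ (j = 0 ∨ (r : ℝ) * 2 ^ j < 2) := by
  set a := r.num.natAbs with ha
  set m := digitLen r with hm
  have ha0 : 0 < a := Int.natAbs_pos.2 (Rat.num_pos.2 hr).ne'
  obtain ⟨s, hs⟩ : ∃ s, Nat.size a = s + 1 :=
    Nat.exists_eq_succ_of_ne_zero (Nat.size_pos.2 ha0).ne'
  have hsm : s + 1 ≤ m := hs ▸ le_max_left _ _
  have halt : a < 2 ^ (s + 1) := hs ▸ Nat.lt_size_self a
  have hale : 2 ^ s ≤ a := Nat.lt_size.1 (by omega)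
  have hden : r.den < 2 ^ m :=
    (Nat.lt_size_self r.den).trans_le (Nat.pow_le_pow_right (by norm_num) (le_max_right _ _))
  have hrat : (r : ℝ) * r.den = a := by
    have h1 : (a : ℤ) = r.num := Int.natAbs_of_nonneg (Rat.num_pos.2 hr).le
    have h2 : r * r.den = ((a : ℤ) : ℚ) := by rw [h1, Rat.mul_den_eq_num]
    exact_mod_cast congrArg (fun x : ℚ => (x : ℝ)) h2
  have hden0 : (0 : ℝ) < r.den := by exact_mod_cast r.den_pos
  refine ⟨m - (s + 1), fun l hl => ?_, ?_, ?_, ?_⟩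
  · rw [digit, if_neg]
    rintro ⟨-, h⟩
    rw [Nat.testBit_lt_two_pow
      (halt.trans_le (Nat.pow_le_pow_right (by norm_num) (by omega)))] at h
    exact Bool.noConfusion h
  · rw [digit, if_pos]
    refine ⟨by omega, ?_⟩
    rw [show m - 1 - (m - (s + 1)) = s by omega, Nat.testBit_eq_decide_div_mod_eq]
    have : a / 2 ^ s = 1 := by
      rw [Nat.div_eq_of_lt_le] <;> rw [pow_succ] at halt <;> omega
    simp [this]
  · have h1 : (2 : ℝ) ^ s ≤ a := by exact_mod_cast hale
    have h2 : (r.den : ℝ) < 2 ^ s * 2 ^ (m - (s + 1) + 1) := by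
      rw [← pow_add, show s + (m - (s + 1) + 1) = m by omega]
      exact_mod_cast hden
    refine lt_of_mul_lt_mul_right ?_ hden0.le
    calc 1 * (r.den : ℝ) < 2 ^ s * 2 ^ (m - (s + 1) + 1) := by rwa [one_mul]
      _ ≤ a * 2 ^ (m - (s + 1) + 1) := by gcongr
      _ = _ := by rw [← hrat]; ring
  · rcases Nat.eq_zero_or_pos (m - (s + 1)) with h0 | h0
    · exact Or.inl h0
    · right
      have hdm : Nat.size r.den = m := by
        rcases max_choice (Nat.size a) (Nat.size r.den) with h | h
        · have : m = Nat.size a := h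
          omega
        · exact h.symm
      have h1 : (2 : ℝ) ^ (m - 1) ≤ r.den := by
        have : 2 ^ (m - 1) ≤ r.den := Nat.lt_size.1 (by omega)
        exact_mod_cast this
      have h2 : (a : ℝ) < 2 ^ (s + 1) := by exact_mod_cast halt
      refine lt_of_mul_lt_mul_right ?_ hden0.le
      calc (r : ℝ) * 2 ^ (m - (s + 1)) * r.den = a * 2 ^ (m - (s + 1)) := by rw [← hrat]; ring
        _ < 2 ^ (s + 1) * 2 ^ (m - (s + 1)) := by gcongr
        _ = 2 * 2 ^ (m - 1) := by
          rw [← pow_add, ← pow_succ']; congr 1; omega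
        _ ≤ 2 * r.den := by gcongr

theorem two_pow_le_of_first_digit {ε : ℝ} (hε : 0 < ε) {j : ℕ} (h : j = 0 ∨ ε * 2 ^ j < 2) :
    (2 : ℝ) ^ (j + 1) ≤ 4 * (1 / ε) + 2 := by
  have h0 : 0 < 1 / ε := by positivity
  rcases h with rfl | h
  · norm_num; positivity
  · have : (2 : ℝ) ^ j ≤ 2 * (1 / ε) := by
      rw [mul_one_div, le_div_iff₀ hε]; linarith
    rw [pow_succ]; linarith

theorem add_two_le_of_first_digit {δ : ℝ} (hδ : 0 < δ) (hδ1 : δ < 1) {j : ℕ}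
    (h : j = 0 ∨ δ * 2 ^ j < 2) : (j + 2 : ℝ) ≤ 2 * Real.log (1 / δ) + 3 := by
  have hlog : 0 ≤ Real.log (1 / δ) := Real.log_nonneg (by rw [le_div_iff₀ hδ]; linarith)
  rcases h with rfl | h
  · rw [Nat.cast_zero]; linarith
  · have h1 : (2 : ℝ) ^ j ≤ 2 * (1 / δ) := by
      rw [mul_one_div, le_div_iff₀ hδ]; linarith
    have h2 := Real.log_le_log (by positivity) h1
    rw [Real.log_pow, Real.log_mul (by norm_num) (by positivity)] at h2
    have h3 := Real.log_two_gt_d9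
    rcases Nat.eq_zero_or_pos j with rfl | hj
    · rw [Nat.cast_zero]; linarith
    · have hj1 : (1 : ℝ) ≤ j := by exact_mod_cast hj
      nlinarith

/-! ### Resource bounds -/

theorem length_le_inputSize (w : List ℤ) : w.length ≤ inputSize w := by
  induction w with
  | nil => simp
  | cons a w ih => simp only [inputSize, List.map_cons, List.sum_cons, List.length_cons, bitLen]
                    at *; omega

theorem abs_getD_le_two_pow_inputSize (w : List ℤ) (i : ℕ) :
    |w.getD i 0| ≤ 2 ^ inputSize w := by
  by_cases hi : i < w.length
  · rw [List.getD_eq_getElem _ _ hi]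
    have h1 : bitLen w[i] ≤ inputSize w :=
      List.single_le_sum (by simp) _ (List.mem_map_of_mem (List.getElem_mem hi))
    have h2 := (natAbs_lt_two_pow_bitLen w[i]).le.trans (Nat.pow_le_pow_right (by norm_num) h1)
    rw [Int.abs_eq_natAbs]
    exact_mod_cast h2
  · rw [List.getD_eq_default _ _ (by omega)]
    simp

theorem bitLen_le_natAbs_add_one (z : ℤ) : bitLen z ≤ z.natAbs + 1 := by
  have := Nat.size_le.2 (Nat.lt_two_pow_self (n := z.natAbs))
  simp only [bitLen]; omega

theorem clog_two_le (n : ℕ) : Nat.clog 2 n ≤ n :=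
  Nat.clog_le_of_le_pow (Nat.lt_two_pow_self).le

theorem primrec_pow {f g : ℕ → ℕ} (hf : Primrec f) (hg : Primrec g) :
    Primrec fun k => f k ^ g k :=
  (Primrec₂.unpaired'.1 Nat.Primrec.pow).comp hf hg

/-- The constant `C` such that, when there are solution-free `k`-subsets, the chance of a success is
at least `1 / (C * k * k) ^ k`; see `LinearEq.pow_le_mul_countFree`. -/
def LinearEq.density (L : LinearEq) : ℕ := 8 * L.weight * (L.weight + 1)

/-- The factor of the resource bound in `exists_run` that depends on the parameter `k`. -/
def LinearEq.paramBound (L : LinearEq) (k : ℕ) : ℕ :=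
  k + L.weight + L.density * k * k + L.density + 6 + (L.density * k * k) ^ k *
    (L.density * k * k) ^ k

theorem LinearEq.computable_paramBound (L : LinearEq) (c r : ℕ) :
    Computable fun k => c * L.paramBound k ^ r := by
  have hid : Primrec fun k : ℕ => k := Primrec.id
  have hq : Primrec fun k => L.density * k * k :=
    Primrec.nat_mul.comp (Primrec.nat_mul.comp (Primrec.const _) hid) hid
  have hD := primrec_pow hq hid
  have hP : Primrec L.paramBound :=
    Primrec.nat_add.comp (Primrec.nat_add.comp (Primrec.nat_add.comp (Primrec.nat_add.comp
      (Primrec.nat_add.comp hid (Primrec.const _)) hq) (Primrec.const _)) (Primrec.const _))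
      (Primrec.nat_mul.comp hD hD)
  exact (Primrec.nat_mul.comp (Primrec.const c) (primrec_pow hP (Primrec.const r))).to_comp

open Classical in
/-- On every input and for all coin tosses the algorithm halts within the resource bound and
outputs the success ratio, scaled by the number of all tuples. -/
theorem exists_run {L : LinearEq} (hhom : L.Homogeneous) (hinv : ¬ L.TranslationInvariant)
    (k : ℕ) (l : List ℤ) (ε δ : ℚ) {i j D T m : ℕ} (hm : m = Nat.clog 2 l.length)
    (hD : D = (L.density * k * k) ^ k) (hT : T = (2 ^ (i + 1) * D) ^ 2 * (j + 2))
    (hi0 : ∀ a < i, digit (digitLen ε) ε.num.natAbs a = 0)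
    (hi1 : digit (digitLen ε) ε.num.natAbs i = 1)
    (hj0 : ∀ a < j, digit (digitLen δ) δ.num.natAbs a = 0)
    (hj1 : digit (digitLen δ) δ.num.natAbs j = 1) (ω : ℕ → Bool) :
    ∃ Z s t, Exec ω (approxProg (List.ofFn L.coeff) L.density)
        (initState ((k : ℤ) :: l) ε δ) s t ∧
      t ≤ (approxProg (List.ofFn L.coeff) L.density).cost Z ∧
      Z + 1 ≤ L.paramBound k *
        ((inputSize ((k : ℤ) :: l) + 1) * (2 ^ (i + 1)) ^ 2 * (j + 2)) ∧
      s.var 1 = T ∧ s.var 0 = (∑ a ∈ Finset.range T, if Success ((k : ℤ) :: l)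
        (List.ofFn L.coeff) k m ω (a * (k * m)) then 1 else 0) * (2 ^ m) ^ k := by
  set w : List ℤ := (k : ℤ) :: l with hw
  set S := inputSize w
  set W := L.weight with hW
  set C := L.density with hC
  have hC1 : 1 ≤ C := by
    have := LinearEq.one_le_weight hhom hinv
    rw [hC, LinearEq.density]; exact Nat.mul_pos (by omega) (by omega)
  have hlen : l.length + 1 ≤ S := length_le_inputSize w
  set E := 2 ^ (i + 1) with hE
  have hE1 : 1 ≤ E := Nat.one_le_two_pow
  have hD1 : 1 ≤ D := by
    rw [hD]
    rcases Nat.eq_zero_or_pos k with rfl | h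
    · simp
    · exact Nat.one_le_pow _ _ (by positivity)
  have hTE : E ≤ T := by
    rw [hT]
    calc E ≤ E * D := Nat.le_mul_of_pos_right _ hD1
      _ ≤ (E * D) ^ 2 := Nat.le_self_pow (by norm_num) _
      _ ≤ _ := Nat.le_mul_of_pos_right _ (by omega)
  have hTj : j + 2 ≤ T := by rw [hT]; exact Nat.le_mul_of_pos_left _ (by positivity)
  have hiE : i + 1 < E := Nat.lt_two_pow_self
  have hmS : m + 1 ≤ S := by have := clog_two_le l.length; omega
  -- All absolute values stay below `2 ^ Z'`.
  set Z' := S * (k + 2) + W + C * k * k + C + T + 2 with hZ'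
  have hSk : S * (k + 2) = S * k + 2 * S := by ring
  have hkS : k ≤ S * k := Nat.le_mul_of_pos_left _ (by omega)
  have hmk : m * k ≤ S * k := Nat.mul_le_mul_right _ (by omega)
  have hsub : (((2 ^ Z' - 1 : ℕ)) : ℤ) = 2 ^ Z' - 1 := by
    rw [Nat.cast_sub Nat.one_le_two_pow]; push_cast; ring
  have hnat : ∀ x : ℕ, x ≤ Z' → (x : ℤ) ≤ 2 ^ Z' - 1 := fun x hx => by
    have : x < 2 ^ Z' := hx.trans_lt Nat.lt_two_pow_self
    have : (x : ℤ) < 2 ^ Z' := by exact_mod_cast this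
    omega
  have hpow : ∀ x : ℕ, x < Z' → (2 : ℤ) ^ x ≤ 2 ^ Z' - 1 := fun x hx => by
    have : (2 : ℤ) ^ x < 2 ^ Z' := pow_lt_pow_right₀ (by norm_num) hx
    omega
  have hY : ∀ z : ℤ, |z| ≤ 2 ^ Z' - 1 → bitLen z ≤ Z' + 1 := fun z hz =>
    bitLen_le_of_lt (by zify; omega)
  have hsum : ((List.ofFn L.coeff).map (|·|)).sum = (W : ℤ) := by
    rw [List.map_ofFn, List.sum_ofFn, hW, LinearEq.weight]; push_cast; rfl
  obtain ⟨s, t, hexec, ht, h1, h0⟩ := approxProg_wp (ω := ω) (w := w) (cs := List.ofFn L.coeff)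
    (n := l.length) (V := 2 ^ S) hY rfl hm hD hT hC1 (by omega) (by omega) (by omega) (by omega)
    (by omega) (by exact_mod_cast hnat (C * k * k) (by omega))
    (by exact_mod_cast hnat (i + 1) (by omega)) (hnat T (by omega)) (hnat C (by omega))
    (by rw [← pow_succ']; exact hpow _ (by omega)) (by rw [← pow_mul]; exact hpow _ (by omega))
    (by exact_mod_cast hnat (l.length + 1) (by omega)) (abs_getD_le_two_pow_inputSize w)
    (hpow S (by omega)) (by
      rw [hsum]
      calc (W : ℤ) * 2 ^ S ≤ 2 ^ W * 2 ^ S := by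
            have : W ≤ 2 ^ W := (Nat.lt_two_pow_self).le
            gcongr
            exact_mod_cast this
        _ = 2 ^ (W + S) := by rw [pow_add]
        _ ≤ _ := hpow _ (by omega))
    (by
      intro a ha
      obtain ⟨b, rfl⟩ := (List.mem_ofFn' _ _).1 ha
      have h1 := bitLen_le_natAbs_add_one (L.coeff b)
      have h2 : (L.coeff b).natAbs ≤ W := Finset.single_le_sum
        (f := fun b => (L.coeff b).natAbs) (fun _ _ => Nat.zero_le _) (Finset.mem_univ b)
      omega)
    (initState w ε δ) rfl (fun _ => rfl) rfl rfl hi0 hi1 hj0 hj1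
  refine ⟨Z' + 1, s, t, hexec, ht, ?_, h1, h0⟩
  have hP : 1 ≤ E ^ 2 * (j + 2) := Nat.mul_pos (by positivity) (by omega)
  have hT' : T = D * D * (E ^ 2 * (j + 2)) := by rw [hT]; ring
  calc Z' + 1 + 1 ≤ (S + 1) * (k + W + C * k * k + C + 6) + T := by
        rw [hZ']
        have : (S + 1) * (k + W + C * k * k + C + 6) = S * (k + 2) + k +
            S * (W + C * k * k + C + 4) + (W + C * k * k + C + 6) := by ring
        omega
    _ ≤ (S + 1) * (k + W + C * k * k + C + 6) * (E ^ 2 * (j + 2)) +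
        (S + 1) * (D * D * (E ^ 2 * (j + 2))) := by
        rw [← hT']
        exact Nat.add_le_add (Nat.le_mul_of_pos_right _ hP) (Nat.le_mul_of_pos_left _ (by omega))
    _ = _ := by rw [LinearEq.paramBound, ← hD, ← hW, ← hC]; ring

/-! ### The approximation scheme -/

open Classical in
/-- With enough samples, the scaled success ratio is within `ε` of the count, relatively, except
with probability `δ`. -/
theorem le_measureReal_approx {L : LinearEq} (hhom : L.Homogeneous)
    (hinv : ¬ L.TranslationInvariant) (I : Instance) {l : List ℤ} (hl : l.Nodup)
    (hlA : l.toFinset = I.A) {ε δ : ℝ} {i j D T m : ℕ} (hm : m = Nat.clog 2 l.length)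
    (hD : D = (L.density * I.k * I.k) ^ I.k) (hT : T = (2 ^ (i + 1) * D) ^ 2 * (j + 2))
    (hε : 1 < ε * 2 ^ (i + 1)) (hδ : 1 < δ * 2 ^ (j + 1)) :
    1 - δ ≤ coinMeasure.real {ω | |(∑ a ∈ Finset.range T, if Success ((I.k : ℤ) :: l)
        (List.ofFn L.coeff) I.k m ω (a * (I.k * m)) then (1 : ℝ) else 0) * (2 ^ m) ^ I.k / T -
          L.countFree I| ≤ ε * L.countFree I} := by
  have hδ0 : 0 < δ := pos_of_mul_pos_left (zero_lt_one.trans hδ) (by positivity)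
  have hε0 : 0 < ε := pos_of_mul_pos_left (zero_lt_one.trans hε) (by positivity)
  have hlm : l.length ≤ 2 ^ m := hm ▸ Nat.le_pow_clog (by norm_num) _
  rcases Nat.eq_zero_or_pos (L.countFree I) with hN | hN
  · -- If nothing is to be counted, no sample ever succeeds, and the output is exact.
    have hno : ∀ ω u, ¬ Success ((I.k : ℤ) :: l) (List.ofFn L.coeff) I.k m ω u := by
      intro ω u hs
      have hcard := card_success hhom hinv I hl hlA hlm
      rw [hN, Finset.card_eq_zero, Finset.filter_eq_empty_iff] at hcard
      refine hcard (Finset.mem_univ fun a : Fin (I.k * m) => ω (u + a))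
        ((success_congr fun a ha => ?_).1 hs)
      simp [extend, ha]
    simp [hno, hN]
    linarith
  have hD1 : 0 < D := by
    rw [hD]
    rcases Nat.eq_zero_or_pos I.k with h | h
    · simp [h]
    · have := LinearEq.one_le_weight hhom hinv
      have : 0 < L.density := Nat.mul_pos (by omega) (by omega)
      positivity
  have hT0 : 0 < T := by rw [hT]; positivity
  have hlow : (2 ^ m) ^ I.k ≤ D * L.countFree I := by
    have h := LinearEq.pow_le_mul_countFree hhom hinv I hN.ne'
    rw [← hlA, List.toFinset_card_of_nodup hl, ← hm] at h
    rw [hD]; exact h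
  have hlow' : ((2 : ℝ) ^ m) ^ I.k ≤ D * L.countFree I := by exact_mod_cast hlow
  have hTr : (0 : ℝ) < T := by exact_mod_cast hT0
  have hDr : (0 : ℝ) < D := by exact_mod_cast hD1
  -- A deviation of `1 / (E * D)` is less than `ε` times the success probability.
  have hbad := measureReal_success_deviation hhom hinv I hl hlA hlm hT0
    (η := 1 / (2 ^ (i + 1) * D)) (by positivity)
  have hexp : 2 * Real.exp (-(2 * T * (1 / (2 ^ (i + 1) * D) : ℝ) ^ 2)) ≤ δ := by
    have h1 : 2 * T * (1 / (2 ^ (i + 1) * D) : ℝ) ^ 2 = 2 * (j + 2) := by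
      rw [hT]; push_cast; field_simp
    have h2 : Real.exp (-(2 * (j + 2 : ℝ))) ≤ (1 / 2) ^ (j + 2) := by
      have h3 : Real.exp (-1) ≤ 1 / 2 := by
        rw [Real.exp_neg, ← one_div]
        exact one_div_le_one_div_of_le (by norm_num)
          (by have := Real.add_one_le_exp (1 : ℝ); linarith)
      calc Real.exp (-(2 * (j + 2 : ℝ))) ≤ Real.exp (((j + 2 : ℕ) : ℝ) * (-1)) :=
            Real.exp_le_exp.2 (by push_cast; linarith [(Nat.cast_nonneg j : (0 : ℝ) ≤ j)])
        _ = Real.exp (-1) ^ (j + 2) := Real.exp_nat_mul _ _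
        _ ≤ _ := pow_le_pow_left₀ (Real.exp_pos _).le h3 _
    have h4 : (1 / 2 : ℝ) ^ (j + 1) * 2 ^ (j + 1) = 1 := by
      rw [← mul_pow]; norm_num
    have h5 : (1 / 2 : ℝ) ^ (j + 1) < δ :=
      lt_of_mul_lt_mul_right (by rw [h4]; exact hδ) (by positivity)
    rw [h1]
    calc 2 * Real.exp (-(2 * (j + 2 : ℝ))) ≤ 2 * (1 / 2) ^ (j + 2) := by linarith
      _ = (1 / 2) ^ (j + 1) := by rw [pow_succ _ (j + 1)]; ring
      _ ≤ δ := h5.le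
  set bad := {ω | T * (1 / (2 ^ (i + 1) * D) : ℝ) ≤ |∑ a ∈ Finset.range T,
    (if Success ((I.k : ℤ) :: l) (List.ofFn L.coeff) I.k m ω (a * (I.k * m)) then (1 : ℝ)
      else 0) - T * (L.countFree I / 2 ^ (I.k * m))|}
  suffices hcover : badᶜ ⊆ {ω | |(∑ a ∈ Finset.range T, if Success ((I.k : ℤ) :: l)
        (List.ofFn L.coeff) I.k m ω (a * (I.k * m)) then (1 : ℝ) else 0) * (2 ^ m) ^ I.k / T -
          L.countFree I| ≤ ε * L.countFree I} by
    have h1 : coinMeasure.real Set.univ ≤ coinMeasure.real bad + coinMeasure.real badᶜ := by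
      rw [← Set.union_compl_self bad]; exact MeasureTheory.measureReal_union_le _ _
    rw [MeasureTheory.probReal_univ] at h1
    have h2 := MeasureTheory.measureReal_mono (μ := coinMeasure) hcover
    linarith
  intro ω hω
  simp only [bad, Set.mem_compl_iff, Set.mem_ofPred_eq, not_le] at hω ⊢
  set X := ∑ a ∈ Finset.range T, if Success ((I.k : ℤ) :: l) (List.ofFn L.coeff) I.k m ω
    (a * (I.k * m)) then (1 : ℝ) else 0
  set M : ℝ := (2 ^ m) ^ I.k with hM
  have hM0 : 0 < M := by positivity
  have hMk : (2 : ℝ) ^ (I.k * m) = M := by rw [hM, ← pow_mul, mul_comm]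
  rw [hMk] at hω
  have heq : X * M / T - L.countFree I = (X - T * (L.countFree I / M)) * (M / T) := by
    field_simp
  rw [heq, abs_mul, abs_of_pos (by positivity : 0 < M / T)]
  have hstep : 1 / (2 ^ (i + 1) * D : ℝ) * M ≤ ε * L.countFree I := by
    have h1 : M / D ≤ L.countFree I := by rw [div_le_iff₀ hDr]; linarith
    have h2 : 1 / (2 : ℝ) ^ (i + 1) ≤ ε := by rw [div_le_iff₀ (by positivity)]; exact hε.le
    calc 1 / (2 ^ (i + 1) * D : ℝ) * M = 1 / 2 ^ (i + 1) * (M / D) := by field_simp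
      _ ≤ ε * L.countFree I := mul_le_mul h2 h1 (by positivity) hε0.le
  calc |X - T * (L.countFree I / M)| * (M / T) ≤ (T * (1 / (2 ^ (i + 1) * D))) * (M / T) := by
        gcongr
    _ = 1 / (2 ^ (i + 1) * D : ℝ) * M := by field_simp
    _ ≤ _ := hstep

end SolutionFree

theorem theorem7p6 (L : SolutionFree.LinearEq) (hhom : L.Homogeneous)
    (hinv : ¬ L.TranslationInvariant) :
    SolutionFree.AdmitsFPTRAS SolutionFree.Instance.Represents L.countFree
      SolutionFree.Instance.k := by
  open SolutionFree in
  classical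
  obtain ⟨c, r, hcost⟩ := (approxProg (List.ofFn L.coeff) L.density).exists_cost_le
  refine ⟨approxProg (List.ofFn L.coeff) L.density, fun k => c * L.paramBound k ^ r,
    ((MvPolynomial.X 0 + 1) * (4 * MvPolynomial.X 1 + 2) ^ 2 * (2 * MvPolynomial.X 2 + 3)) ^ r,
    L.computable_paramBound c r, ?_⟩
  rintro I w ⟨l, hl, hlA, rfl⟩ ε δ hε hδ hδ1
  have hε' : (0 : ℝ) < ε := by exact_mod_cast hε
  have hδ' : (0 : ℝ) < δ := by exact_mod_cast hδ
  have hδ1' : (δ : ℝ) < 1 := by exact_mod_cast hδ1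
  obtain ⟨i, hi0, hi1, hiε, hiε'⟩ := exists_first_digit hε
  obtain ⟨j, hj0, hj1, hjδ, hjδ'⟩ := exists_first_digit hδ
  obtain ⟨D, hD⟩ : ∃ D, D = (L.density * I.k * I.k) ^ I.k := ⟨_, rfl⟩
  obtain ⟨T, hT⟩ : ∃ T, T = (2 ^ (i + 1) * D) ^ 2 * (j + 2) := ⟨_, rfl⟩
  have hT0 : T ≠ 0 := by
    have : D ≠ 0 := by
      rw [hD]
      rcases Nat.eq_zero_or_pos I.k with h | h
      · simp [h]
      · have := LinearEq.one_le_weight hhom hinv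
        have : 0 < L.density := Nat.mul_pos (by omega) (by omega)
        positivity
    rw [hT]; positivity
  have hrun := exists_run hhom hinv I.k l ε δ rfl hD hT hi0 hi1 hj0 hj1
  refine ⟨fun ω => ?_, ?_⟩
  · obtain ⟨Z, s, t, hexec, ht, hZ, h1, -⟩ := hrun ω
    refine ⟨_, t, ⟨s, hexec, by rw [h1]; exact_mod_cast hT0, rfl⟩, ?_⟩
    have hE := two_pow_le_of_first_digit hε' hiε'
    have hG := add_two_le_of_first_digit hδ' hδ1' hjδ'
    set S := inputSize ((I.k : ℤ) :: l)
    have htn : t ≤ c * (L.paramBound I.k * ((S + 1) * (2 ^ (i + 1)) ^ 2 * (j + 2))) ^ r :=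
      (ht.trans (hcost Z)).trans (Nat.mul_le_mul_left _ (Nat.pow_le_pow_left hZ r))
    have htr : (t : ℝ) ≤
        c * (L.paramBound I.k * ((S + 1) * (2 ^ (i + 1)) ^ 2 * (j + 2))) ^ r := by
      exact_mod_cast htn
    simp only [map_pow, map_mul, map_add, MvPolynomial.eval_X, map_one, map_ofNat]
    simp only [Matrix.cons_val_zero, Matrix.cons_val_one, Matrix.cons_val]
    calc (t : ℝ) ≤ c * L.paramBound I.k ^ r * ((S + 1) * (2 ^ (i + 1)) ^ 2 * (j + 2)) ^ r := by
          rw [mul_assoc, ← mul_pow]; exact htr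
      _ ≤ c * L.paramBound I.k ^ r * ((S + 1) * (4 * (1 / (ε : ℝ)) + 2) ^ 2 *
            (2 * Real.log (1 / (δ : ℝ)) + 3)) ^ r := by
          gcongr
      _ = _ := by push_cast; rfl
  · refine (le_measureReal_approx hhom hinv I hl hlA rfl hD hT hiε hjδ).trans
      (MeasureTheory.measureReal_mono fun ω hω => ?_)
    obtain ⟨Z, s, t, hexec, -, -, h1, h0⟩ := hrun ω
    refine ⟨_, t, ⟨s, hexec, by rw [h1]; exact_mod_cast hT0, rfl⟩, ?_⟩
    have hz : (((s.var 0 : ℚ) / (s.var 1 : ℚ) : ℚ) : ℝ) = (∑ a ∈ Finset.range T,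
        if Success ((I.k : ℤ) :: l) (List.ofFn L.coeff) I.k (Nat.clog 2 l.length) ω
          (a * (I.k * Nat.clog 2 l.length)) then (1 : ℝ) else 0) *
          (2 ^ Nat.clog 2 l.length) ^ I.k / T := by
      rw [h0, h1]; push_cast; simp only [apply_ite ((↑) : ℚ → ℝ), Rat.cast_one, Rat.cast_zero]
    rw [Set.mem_ofPred_eq, ← hz, abs_le] at hω
    have e1 : ((1 - ε) * (L.countFree I : ℚ) : ℝ) ≤ (((s.var 0 : ℚ) / (s.var 1 : ℚ) : ℚ) : ℝ) := by
      push_cast at hω ⊢; linarith [hω.1]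
    have e2 : (((s.var 0 : ℚ) / (s.var 1 : ℚ) : ℚ) : ℝ) ≤ ((1 + ε) * (L.countFree I : ℚ) : ℝ) := by
      push_cast at hω ⊢; linarith [hω.2]
    exact ⟨by exact_mod_cast e1, by exact_mod_cast e2⟩
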